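/- **Setting.** Let $r=|x|$ on $\mathbb R^2$, $\partial=\frac1{\sqrt2}(\partial_1-i\partial_2)$, $\bar\partial=\frac1{\sqrt2}(\partial_1+i\partial_2)$. For formal power series in a real parameter $\theta$ with smooth complex coefficients let $$f*g=\sum_{n\ge0}\frac1{n!}\Big(\frac{i\theta}{2}\Big)^n f\,\big(\overleftarrow\partial_\mu\epsilon^{\mu\nu}\overrightarrow\partial_\nu\big)^n g,\qquad \epsilon^{12}=-\epsilon^{21}=1,$$ be the formal Moyal product, and $[f,g]_*=f*g-g*f$. Let $\phi=\sum_{k\ge0}\theta^k\phi_k$ and $A=\sum_{k\ge0}\theta^kA_k$ be formal series whose coefficients are smooth complex functions on $\mathbb R^2\setminus K$ for some compact set $K$ (for instance, the zero set of $\phi_0$), let $\bar\phi=\sum\theta^k\bar\phi_k$, $\bar A=\sum\theta^k\bar A_k$, and suppose that they solve, at every order in $\theta$, the noncommutative vortex equations on $\mathbb R^2\setminus K$: $$\bar\partial\phi-i\bar A*\phi=0,\qquad B+\phi*\bar\phi-1=0,\qquad B=-i\big(\partial\bar A-\bar\partial A-i[A,\bar A]_*\big).$$ For $k\ge1$ let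 $C_k$ be the coefficient of $\theta^k$ in $-[A,\bar A]_*+\phi*\bar\phi$ minus $(\phi_k\bar\phi_0+\phi_0\bar\phi_k)$, let $D_k$ be the coefficient of $\theta^k$ in $-i\bar A*\phi$ minus $(-i\bar A_k\phi_0-i\bar A_0\phi_k)$, and, where $\phi_0\ne0$, let $d_k=D_k/\phi_0$ and $E_k=-C_k+\partial d_k+\bar\partial\bar d_k$. **Theorem.** Assume that $|\phi_0|\to1$ as $r\to\infty$, that the gauge is fixed by $\operatorname{Im}\phi=0$, i.e. $\operatorname{Im}\phi_k=0$ on $\mathbb R^2\setminus K$ for all $k\ge0$, and that for every $k\ge1$ the function $\phi_k$ is bounded near infinity. Then for every $k\ge1$, as $r\to\infty$, $$\phi_k=O(r^{-2k}),\quad A_k=O(r^{-2k-1}),\quad D_k=O(r^{-2k-1}),\quad C_k=O(r^{-2k-2}),\quad E_k=O(r^{-2k-2}).$$ -/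

import Mathlib

open Filter Asymptotics Topology

noncomputable section

namespace NCVortex

/-- The Euclidean plane `ℝ²`, with coordinates `x 0 = x¹`, `x 1 = x²` and `r = ‖x‖`. -/
abbrev Plane := EuclideanSpace ℝ (Fin 2)

/-- The real partial derivative `∂_μ f`. -/
def pd (μ : Fin 2) (f : Plane → ℂ) : Plane → ℂ :=
  fun x => fderiv ℝ f x (EuclideanSpace.single μ (1 : ℝ))

/-- `∂ = (∂₁ - i ∂₂) / √2`. -/
def dz (f : Plane → ℂ) : Plane → ℂ :=
  fun x => (1 / (Real.sqrt 2 : ℂ)) * (pd 0 f x - Complex.I * pd 1 f x)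

/-- `∂̄ = (∂₁ + i ∂₂) / √2`. -/
def dzbar (f : Plane → ℂ) : Plane → ℂ :=
  fun x => (1 / (Real.sqrt 2 : ℂ)) * (pd 0 f x + Complex.I * pd 1 f x)

/-- A formal power series `∑ θᵏ f_k` in the real parameter `θ`, given by its coefficients. -/
abbrev FormalField := ℕ → Plane → ℂ

/-- The complex conjugate of a formal field. -/
def conjField (f : FormalField) : FormalField :=
  fun k x => starRingEnd ℂ (f k x)

/-- The `n`-th power of the bidifferential operator `ε^{μν} ∂_μ ⊗ ∂_ν` (`ε^{12} = 1`),
applied to `f` (from the right) and `g` (from the left) and multiplied out. -/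
def bidiff : ℕ → (Plane → ℂ) → (Plane → ℂ) → Plane → ℂ
  | 0, f, g => fun x => f x * g x
  | n + 1, f, g => fun x => bidiff n (pd 0 f) (pd 1 g) x - bidiff n (pd 1 f) (pd 0 g) x

/-- The formal Moyal product, `f * g = ∑ₙ (1/n!) (iθ/2)ⁿ f (ε^{μν} ∂_μ ⊗ ∂_ν)ⁿ g`,
extended `θ`-bilinearly to formal fields; the value at `k` is the coefficient of `θᵏ`. -/
def moyal (f g : FormalField) : FormalField :=
  fun k x => ∑ p ∈ Finset.HasAntidiagonal.antidiagonal k,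
    ∑ q ∈ Finset.HasAntidiagonal.antidiagonal p.2,
    (1 / (p.1.factorial : ℂ)) * (Complex.I / 2) ^ p.1 * bidiff p.1 (f q.1) (g q.2) x

/-- Coefficient of `θᵏ` in the Moyal commutator `[A, Ā]_*`. -/
def moyalComm (A : FormalField) : FormalField :=
  fun k x => moyal A (conjField A) k x - moyal (conjField A) A k x

/-- Coefficient of `θᵏ` in the magnetic field `B = -i (∂Ā - ∂̄A - i [A, Ā]_*)`. -/
def magnetic (A : FormalField) : FormalField :=
  fun k x => -Complex.I *
    (dz (conjField A k) x - dzbar (A k) x - Complex.I * moyalComm A k x)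

/-- Coefficient of `θᵏ` in `D̄ * φ = ∂̄φ - i Ā * φ`. -/
def covDbar (A φ : FormalField) : FormalField :=
  fun k x => dzbar (φ k) x - Complex.I * moyal (conjField A) φ k x

/-- The vortex equations `D̄ * φ = 0`, `B + φ * φ̄ - 1 = 0`, to all orders in `θ`, on a set. -/
def IsVortexOn (A φ : FormalField) (U : Set Plane) : Prop :=
  ∀ k : ℕ, ∀ x ∈ U, covDbar A φ k x = 0 ∧
    magnetic A k x + moyal φ (conjField φ) k x - (if k = 0 then 1 else 0) = 0

/-- `C_k`: the coefficient of `θᵏ` in `-[A, Ā]_* + φ * φ̄`, minus `φ_k φ̄₀ + φ₀ φ̄_k`. -/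
def sourceC (A φ : FormalField) (k : ℕ) (x : Plane) : ℂ :=
  -moyalComm A k x + moyal φ (conjField φ) k x
    - (φ k x * conjField φ 0 x + φ 0 x * conjField φ k x)

/-- `D_k`: the coefficient of `θᵏ` in `-i Ā * φ`, minus `-i Ā_k φ₀ - i Ā₀ φ_k`. -/
def sourceD (A φ : FormalField) (k : ℕ) (x : Plane) : ℂ :=
  -Complex.I * moyal (conjField A) φ k x
    - (-Complex.I * conjField A k x * φ 0 x - Complex.I * conjField A 0 x * φ k x)

/-- `d_k = D_k / φ₀`. -/
def sourceQuot (A φ : FormalField) (k : ℕ) (x : Plane) : ℂ :=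
  sourceD A φ k x / φ 0 x

/-- `E_k = -C_k + ∂ d_k + ∂̄ (conj d_k)`. -/
def sourceE (A φ : FormalField) (k : ℕ) (x : Plane) : ℂ :=
  -sourceC A φ k x + dz (sourceQuot A φ k) x
    + dzbar (fun y => starRingEnd ℂ (sourceQuot A φ k y)) x

/-- `f = O(r⁻ⁿ)` as `r = ‖x‖ → ∞`. -/
def DecaysAtRate (f : Plane → ℂ) (n : ℕ) : Prop :=
  f =O[Bornology.cobounded Plane] fun x => (‖x‖ ^ n)⁻¹

end NCVortex

end

/-! Far more holds than the stated rates: at every order `k ≥ 1` all these functions decay faster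
than any power of `r`, together with all their derivatives (`RapidDecay`).

In the real gauge write `|φ₀| = eᵘ`. The first equation at order zero gives `Ā₀ = -i ∂̄u`, and the
second becomes `Δu = e²ᵘ - 1` with `u → 0`. At order `k ≥ 1` put `φ_k = φ₀ v`. Then `Ā_k = -i (∂̄v +
d_k)`, and the second equation becomes `Δv = 2 φ₀² v - E_k`. Both equations are massive: where the
unknown is positive, its Laplacian is at least the unknown minus the source, and symmetrically where
it is negative. Comparison with the barrier `M r⁻²ⁿ + ε r²`, followed by `ε → 0`, shows that bounded
solutions inherit every power rate of the source (`exists_re_le_of_laplacian_ge`).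

Derivatives follow from an interior gradient estimate on balls of fixed radius (`re_pd_le`), which
costs no decay. Control of `f` and `Δf` therefore gives one more derivative of `f`, and the equation
itself feeds this bootstrap (`DerivsDecay.succ_of_laplacian`).

The sources `C_k`, `D_k`, `E_k` involve only orders below `k`, and each of their terms has a rapidly
decaying factor: some `A_j`, some derivative of `φ_j`, or some `φ_j` with `j ≠ 0`. Rapidly decaying
functions absorb products with functions bounded with all derivatives and are stable under
differentiation, so the sources decay rapidly and strong induction on `k` closes. -/

namespace NCVortex

open scoped ContDiff

/-! ### Partial derivatives -/

/-- The coordinate vector `e_μ`. -/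
noncomputable abbrev unitVec (μ : Fin 2) : Plane := EuclideanSpace.single μ (1 : ℝ)

/-- The Laplacian `∂₁² + ∂₂²`. -/
noncomputable def laplacian (f : Plane → ℂ) : Plane → ℂ :=
  fun x => pd 0 (pd 0 f) x + pd 1 (pd 1 f) x

lemma pd_add {f g : Plane → ℂ} {x : Plane} (μ : Fin 2) (hf : DifferentiableAt ℝ f x)
    (hg : DifferentiableAt ℝ g x) : pd μ (fun y => f y + g y) x = pd μ f x + pd μ g x := by
  simp only [pd]
  rw [fderiv_fun_add hf hg]; rfl

lemma pd_sub {f g : Plane → ℂ} {x : Plane} (μ : Fin 2) (hf : DifferentiableAt ℝ f x)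
    (hg : DifferentiableAt ℝ g x) : pd μ (fun y => f y - g y) x = pd μ f x - pd μ g x := by
  simp only [pd]
  rw [fderiv_fun_sub hf hg]; rfl

lemma pd_mul {f g : Plane → ℂ} {x : Plane} (μ : Fin 2) (hf : DifferentiableAt ℝ f x)
    (hg : DifferentiableAt ℝ g x) :
    pd μ (fun y => f y * g y) x = pd μ f x * g x + f x * pd μ g x := by
  simp only [pd]
  rw [fderiv_fun_mul hf hg]
  simp
  ring

lemma pd_const (μ : Fin 2) (c : ℂ) (x : Plane) : pd μ (fun _ => c) x = 0 := by
  simp [pd]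

lemma pd_const_mul {f : Plane → ℂ} {x : Plane} (μ : Fin 2) (c : ℂ)
    (hf : DifferentiableAt ℝ f x) : pd μ (fun y => c * f y) x = c * pd μ f x := by
  rw [pd_mul μ (differentiableAt_const c) hf, pd_const]
  ring

lemma pd_inv {f : Plane → ℂ} {x : Plane} (μ : Fin 2) (hf : DifferentiableAt ℝ f x)
    (h0 : f x ≠ 0) : pd μ (fun y => (f y)⁻¹) x = -pd μ f x / f x ^ 2 := by
  have h := (((hasDerivAt_inv h0).hasFDerivAt.restrictScalars ℝ).comp x hf.hasFDerivAt).fderiv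
  simp only [pd]
  rw [show (fun y => (f y)⁻¹) = (fun z : ℂ => z⁻¹) ∘ f from rfl, h]
  simp
  ring

lemma pd_conj {f : Plane → ℂ} {x : Plane} (μ : Fin 2) (hf : DifferentiableAt ℝ f x) :
    pd μ (fun y => starRingEnd ℂ (f y)) x = starRingEnd ℂ (pd μ f x) := by
  have h := ((Complex.conjCLE.toContinuousLinearMap.hasFDerivAt).comp x hf.hasFDerivAt).fderiv
  simp only [pd]
  rw [show (fun y => starRingEnd ℂ (f y)) = (Complex.conjCLE.toContinuousLinearMap : ℂ → ℂ) ∘ f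
    from rfl, h]
  simp

lemma pd_congr {f g : Plane → ℂ} {x : Plane} (μ : Fin 2) (h : f =ᶠ[𝓝 x] g) :
    pd μ f x = pd μ g x := by
  simp only [pd]
  rw [h.fderiv_eq]

lemma pd_pd_comm {f : Plane → ℂ} {x : Plane} (hf : ContDiffAt ℝ ∞ f x) (μ ν : Fin 2) :
    pd μ (pd ν f) x = pd ν (pd μ f) x := by
  have hd : DifferentiableAt ℝ (fderiv ℝ f) x :=
    (hf.fderiv_right (m := ∞) (by simp)).differentiableAt (by simp)
  have key : ∀ a b : Fin 2, pd a (pd b f) x = fderiv ℝ (fderiv ℝ f) x (unitVec a) (unitVec b) := by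
    intro a b
    change fderiv ℝ (fun y => fderiv ℝ f y (unitVec b)) x (unitVec a) = _
    rw [fderiv_clm_apply hd (differentiableAt_const _)]
    simp
  rw [key, key]
  exact (hf.isSymmSndFDerivAt (by simpa using ENat.LEInfty.out)).eq _ _

lemma contDiffAt_pd {f : Plane → ℂ} {x : Plane} (μ : Fin 2) (hf : ContDiffAt ℝ ∞ f x) :
    ContDiffAt ℝ ∞ (pd μ f) x := by
  have h : ContDiffAt ℝ ∞ (fderiv ℝ f) x := hf.fderiv_right (by simp)
  exact h.clm_apply contDiffAt_const

lemma hasDerivAt_line {f : Plane → ℂ} {x : Plane} (μ : Fin 2) (t : ℝ)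
    (hf : DifferentiableAt ℝ f (x + t • unitVec μ)) :
    HasDerivAt (fun s : ℝ => f (x + s • unitVec μ)) (pd μ f (x + t • unitVec μ)) t := by
  have h1 : HasDerivAt (fun s : ℝ => x + s • unitVec μ) (unitVec μ) t := by
    simpa using ((hasDerivAt_id t).smul_const (unitVec μ)).const_add x
  exact hf.hasFDerivAt.comp_hasDerivAt t h1

/-! ### The maximum principle -/

/-- `z` is twice differentiable at `x` along the line through `x` in the direction `e`, with
second derivative `a`. -/
def HasLineDerivTwo (z : Plane → ℝ) (e : Plane) (a : ℝ) (x : Plane) : Prop :=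
  ∃ g : ℝ → ℝ, (∀ᶠ t in 𝓝 (0 : ℝ), HasDerivAt (fun s : ℝ => z (x + s • e)) (g t) t) ∧
    HasDerivAt g a 0

lemma HasLineDerivTwo.sub {z w : Plane → ℝ} {e : Plane} {a b : ℝ} {x : Plane}
    (hz : HasLineDerivTwo z e a x) (hw : HasLineDerivTwo w e b x) :
    HasLineDerivTwo (fun y => z y - w y) e (a - b) x := by
  obtain ⟨g, hg, hg'⟩ := hz
  obtain ⟨k, hk, hk'⟩ := hw
  refine ⟨fun t => g t - k t, ?_, hg'.sub hk'⟩
  filter_upwards [hg, hk] with t h1 h2 using h1.sub h2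

lemma HasLineDerivTwo.const_mul {z : Plane → ℝ} {e : Plane} {a : ℝ} {x : Plane} (c : ℝ)
    (hz : HasLineDerivTwo z e a x) : HasLineDerivTwo (fun y => c * z y) e (c * a) x := by
  obtain ⟨g, hg, hg'⟩ := hz
  refine ⟨fun t => c * g t, ?_, hg'.const_mul c⟩
  filter_upwards [hg] with t h1 using h1.const_mul c

/-- If `a > 0`, the second derivative test makes the point a local minimum along the line as well.
The restriction is then locally constant, which forces `a = 0`. -/
lemma HasLineDerivTwo.nonpos_of_isLocalMax {z : Plane → ℝ} {e : Plane} {a : ℝ} {x : Plane}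
    (hz : HasLineDerivTwo z e a x) (hmax : IsLocalMax z x) : a ≤ 0 := by
  obtain ⟨g, hg, hg'⟩ := hz
  by_contra! ha
  set f : ℝ → ℝ := fun s => z (x + s • e) with hf
  have hcont : Tendsto (fun s : ℝ => x + s • e) (𝓝 0) (𝓝 x) := by
    have : Continuous (fun s : ℝ => x + s • e) := by fun_prop
    simpa using this.tendsto 0
  have hfmax : IsLocalMax f 0 := by
    have := hcont.eventually hmax
    filter_upwards [this] with s hs
    simpa [hf] using hs
  have hderiv : deriv f =ᶠ[𝓝 0] g := hg.mono fun t ht => ht.deriv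
  have hdd : deriv (deriv f) 0 = a := by rw [hderiv.deriv_eq, hg'.deriv]
  have hfmin : IsLocalMin f 0 :=
    isLocalMin_of_deriv_deriv_pos (hdd ▸ ha) hfmax.deriv_eq_zero hg.self_of_nhds.continuousAt
  have hconst : f =ᶠ[𝓝 0] fun _ => f 0 := by
    filter_upwards [hfmax, hfmin] with s h1 h2 using le_antisymm h1 h2
  have hz0 : deriv f =ᶠ[𝓝 0] fun _ => 0 := by
    refine hconst.deriv.trans ?_
    simp
  rw [hz0.deriv_eq] at hdd
  simp at hdd
  exact ha.ne hdd

lemma hasLineDerivTwo_re {f : Plane → ℂ} {x : Plane} (hf : ContDiffAt ℝ ∞ f x) (μ : Fin 2) :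
    HasLineDerivTwo (fun y => (f y).re) (unitVec μ) (pd μ (pd μ f) x).re x := by
  have hcont : Tendsto (fun s : ℝ => x + s • unitVec μ) (𝓝 0) (𝓝 x) := by
    have : Continuous (fun s : ℝ => x + s • unitVec μ) := by fun_prop
    simpa using this.tendsto 0
  have h1 : ContDiffAt ℝ 1 f x := hf.of_le (by exact_mod_cast le_top)
  refine ⟨fun t => (pd μ f (x + t • unitVec μ)).re, ?_, ?_⟩
  · filter_upwards [hcont.eventually (h1.eventually (by simp))] with t ht
    exact Complex.reCLM.hasFDerivAt.comp_hasDerivAt t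
      (hasDerivAt_line μ t (ht.differentiableAt (by simp)))
  · have := hasDerivAt_line (f := pd μ f) (x := x) μ 0
      (by simpa using (contDiffAt_pd μ hf).differentiableAt (by simp))
    have := Complex.reCLM.hasFDerivAt.comp_hasDerivAt (0 : ℝ) this
    simp only [zero_smul, add_zero] at this
    exact this

/-- Weak maximum principle: a continuous function on a compact set, which has a positive sum of
two second directional derivatives at interior points wherever it is positive, and is nonpositive on the
boundary, is nonpositive. -/
lemma nonpos_of_laplacian_pos {e e' : Plane} {S : Set Plane} (hS : IsCompact S) {z : Plane → ℝ}
    (hz : ContinuousOn z S)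
    (h : ∀ x ∈ S, 0 < z x → S ∈ 𝓝 x ∧ ∃ a b : ℝ, HasLineDerivTwo z e a x ∧
      HasLineDerivTwo z e' b x ∧ 0 < a + b) :
    ∀ x ∈ S, z x ≤ 0 := by
  intro x hx
  obtain ⟨y, hy, hmax⟩ := hS.exists_isMaxOn ⟨x, hx⟩ hz
  refine (hmax hx).trans ?_
  by_contra! hpos
  obtain ⟨hn, a, b, ha, hb, hab⟩ := h y hy hpos
  have hl := hmax.isLocalMax hn
  linarith [ha.nonpos_of_isLocalMax hl, hb.nonpos_of_isLocalMax hl]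

/-! ### The interior gradient estimate -/

lemma hasLineDerivTwo_of_quadratic {z : Plane → ℝ} {e x : Plane} {α β γ : ℝ}
    (h : ∀ s : ℝ, z (x + s • e) = α + β * s + γ * s ^ 2) : HasLineDerivTwo z e (2 * γ) x := by
  refine ⟨fun t => β + 2 * γ * t, Eventually.of_forall fun t => ?_, ?_⟩
  · rw [funext h]
    have h1 := ((hasDerivAt_id t).const_mul β).const_add α
    have h2 := ((hasDerivAt_id t).pow 2).const_mul γ
    exact (h1.add h2).congr_deriv (by simp; ring)
  · simpa using ((hasDerivAt_id (0 : ℝ)).const_mul (2 * γ)).const_add β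

/-- Meant for a reflection `ρ` in a coordinate line: it maps lines in direction `e` to such lines
with speed `σ = ±1`, and the second derivative only sees `σ² = 1`. -/
lemma HasLineDerivTwo.comp_line {z : Plane → ℝ} {e y : Plane} {a σ : ℝ} {ρ : Plane → Plane}
    (hz : HasLineDerivTwo z e a (ρ y)) (hσ : σ * σ = 1)
    (h : ∀ s : ℝ, ρ (y + s • e) = ρ y + (σ * s) • e) :
    HasLineDerivTwo (fun y => z (ρ y)) e a y := by
  obtain ⟨g, hg, hg'⟩ := hz
  have hlin : ∀ t : ℝ, HasDerivAt (fun s : ℝ => σ * s) σ t := fun t => by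
    simpa using (hasDerivAt_id t).const_mul σ
  refine ⟨fun t => g (σ * t) * σ, ?_, ?_⟩
  · have ht : Tendsto (fun s : ℝ => σ * s) (𝓝 0) (𝓝 0) := by
      simpa using (hlin 0).continuousAt.tendsto
    filter_upwards [ht.eventually hg] with t h1
    simp only [h]
    exact h1.comp t (hlin t)
  · have h0 : HasDerivAt g a (σ * 0) := by simpa using hg'
    exact ((h0.comp 0 (hlin 0)).mul_const σ).congr_deriv (by rw [mul_assoc, hσ, mul_one])

lemma norm_sq_eq_of_ne {i j : Fin 2} (hij : i ≠ j) (v : Plane) :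
    ‖v‖ ^ 2 = v i ^ 2 + v j ^ 2 := by
  rw [EuclideanSpace.norm_sq_eq, Fin.sum_univ_two]
  fin_cases i <;> fin_cases j <;> simp_all [add_comm]

lemma laplacian_eq_of_ne {i j : Fin 2} (hij : i ≠ j) (f : Plane → ℂ) (x : Plane) :
    laplacian f x = pd i (pd i f) x + pd j (pd j f) x := by
  fin_cases i <;> fin_cases j <;> simp_all [laplacian, add_comm]

lemma add_smul_unitVec_same (y : Plane) (s : ℝ) (i : Fin 2) : (y + s • unitVec i) i = y i + s := by
  simp

lemma add_smul_unitVec_ne {i j : Fin 2} (hij : i ≠ j) (y : Plane) (s : ℝ) :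
    (y + s • unitVec i) j = y j := by
  simp [hij.symm]

/-- Interior gradient estimate for the Laplacian, by comparing the odd part of `f` across a line
with a quadratic barrier. -/
lemma re_pd_le {f : Plane → ℂ} {x : Plane} {i j : Fin 2} (hij : i ≠ j) {M N : ℝ}
    (h : ∀ y, ‖y - x‖ ≤ 2 → ContDiffAt ℝ ∞ f y ∧ ‖f y‖ ≤ M ∧ ‖laplacian f y‖ < N) :
    (pd i f x).re ≤ 2 * M + N / 2 := by
  have hM : 0 ≤ M := (norm_nonneg _).trans (h x (by simp)).2.1
  have hN : 0 < N := (norm_nonneg _).trans_lt (h x (by simp)).2.2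
  -- Reflection in the line `y i = x i`. The odd part of `Re f` under `ρ` vanishes on that line,
  -- which is one side of the rectangle `S`.
  set ρ : Plane → Plane := fun y => y - (2 * (y i - x i)) • unitVec i with hρ
  have hρi : ∀ y, (ρ y) i - x i = -(y i - x i) := fun y => by simp [hρ]; ring
  have hρj : ∀ y, (ρ y) j = y j := fun y => by simp [hρ, hij.symm]
  set S : Set Plane := {y | |y j - x j| ≤ 1 ∧ 0 ≤ y i - x i ∧ y i - x i ≤ 1} with hS
  have hnear : ∀ y ∈ S, ‖y - x‖ ≤ 2 ∧ ‖ρ y - x‖ ≤ 2 := by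
    rintro y ⟨h1, h2, h3⟩
    have h1' := abs_le.1 h1
    constructor
    · refine abs_le_of_sq_le_sq' ?_ (by norm_num) |>.2
      rw [norm_sq_eq_of_ne hij]
      simp only [PiLp.sub_apply]
      nlinarith
    · refine abs_le_of_sq_le_sq' ?_ (by norm_num) |>.2
      rw [norm_sq_eq_of_ne hij]
      simp only [PiLp.sub_apply, hρi, hρj]
      nlinarith
  have hclosed : IsClosed S := by
    have c1 : IsClosed {y : Plane | |y j - x j| ≤ 1} := isClosed_le (by fun_prop) continuous_const
    have c2 : IsClosed {y : Plane | 0 ≤ y i - x i} := isClosed_le continuous_const (by fun_prop)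
    have c3 : IsClosed {y : Plane | y i - x i ≤ 1} := isClosed_le (by fun_prop) continuous_const
    exact c1.inter (c2.inter c3)
  have hcompact : IsCompact S := by
    refine (isCompact_closedBall x 2).of_isClosed_subset hclosed fun y hy => ?_
    rw [mem_closedBall_iff_norm]
    exact (hnear y hy).1
  -- The `M` summand is harmonic and at least `M` on the other three sides of `S`. The `N` summand
  -- is nonnegative on `S` with Laplacian `-N`. The slope of `ψ` at `x` in direction `i` is `2M +
  -- N/2`, the bound sought.
  set ψ : Plane → ℝ := fun y => M * ((y j - x j) ^ 2 + (y i - x i) * (2 - (y i - x i)))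
    + N / 2 * ((y i - x i) * (1 - (y i - x i))) with hψ
  set z : Plane → ℝ := fun y => 1 / 2 * ((f y).re - (f (ρ y)).re) - ψ y with hz
  have hρcont : Continuous ρ := by fun_prop
  have hcontz : ContinuousOn z S := by
    intro y hy
    have c1 : ContinuousAt f y := (h y (hnear y hy).1).1.continuousAt
    have c2 : ContinuousAt (fun y => f (ρ y)) y :=
      ContinuousAt.comp (h _ (hnear y hy).2).1.continuousAt hρcont.continuousAt
    have c3 : Continuous ψ := by fun_prop
    have c4 : ContinuousAt (fun y => (f y).re) y := Complex.continuous_re.continuousAt.comp c1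
    have c5 : ContinuousAt (fun y => (f (ρ y)).re) y :=
      Complex.continuous_re.continuousAt.comp c2
    exact (((c4.sub c5).const_mul (1 / 2)).sub c3.continuousAt).continuousWithinAt
  have hmain : ∀ y ∈ S, z y ≤ 0 := by
    refine nonpos_of_laplacian_pos (e := unitVec i) (e' := unitVec j) hcompact hcontz ?_
    intro y hy hpos
    obtain ⟨h1, h2, h3⟩ := hy
    have hfy := h y (hnear y ⟨h1, h2, h3⟩).1
    have hfρ := h (ρ y) (hnear y ⟨h1, h2, h3⟩).2
    have b1 := (abs_le.1 ((Complex.abs_re_le_norm (f y)).trans hfy.2.1)).2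
    have b2 := (abs_le.1 ((Complex.abs_re_le_norm (f (ρ y))).trans hfρ.2.1)).1
    have hpos' : ψ y < 1 / 2 * ((f y).re - (f (ρ y)).re) := by simpa [hz] using hpos
    have hψM : ψ y < M := by linarith
    have i1 : |y j - x j| < 1 := by
      refine lt_of_le_of_ne h1 fun he => ?_
      have hsq : (y j - x j) ^ 2 = 1 := by rw [← sq_abs, he]; norm_num
      simp only [hψ, hsq] at hψM
      nlinarith [mul_nonneg hM (mul_nonneg h2 (by linarith : 0 ≤ 2 - (y i - x i))),
        mul_nonneg hN.le (mul_nonneg h2 (by linarith : 0 ≤ 1 - (y i - x i)))]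
    have i2 : 0 < y i - x i := by
      refine lt_of_le_of_ne h2 fun he => ?_
      have : ρ y = y := by simp [hρ, ← he]
      simp only [this, hψ, ← he] at hpos'
      nlinarith [mul_nonneg hM (sq_nonneg (y j - x j))]
    have i3 : y i - x i < 1 := by
      refine lt_of_le_of_ne h3 fun he => ?_
      simp only [hψ, he] at hψM
      nlinarith [mul_nonneg hM (sq_nonneg (y j - x j))]
    refine ⟨?_, ?_⟩
    · have o1 : ∀ᶠ w : Plane in 𝓝 y, |w j - x j| < 1 :=
        (isOpen_lt (by fun_prop) continuous_const).mem_nhds i1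
      have o2 : ∀ᶠ w : Plane in 𝓝 y, 0 < w i - x i :=
        (isOpen_lt continuous_const (by fun_prop)).mem_nhds i2
      have o3 : ∀ᶠ w : Plane in 𝓝 y, w i - x i < 1 :=
        (isOpen_lt (by fun_prop) continuous_const).mem_nhds i3
      filter_upwards [o1, o2, o3] with w w1 w2 w3 using ⟨w1.le, w2.le, w3.le⟩
    · have ψi : HasLineDerivTwo ψ (unitVec i) (2 * (-M - N / 2)) y := by
        refine hasLineDerivTwo_of_quadratic (α := ψ y)
          (β := M * (2 - 2 * (y i - x i)) + N / 2 * (1 - 2 * (y i - x i))) fun s => ?_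
        simp only [hψ, add_smul_unitVec_same, add_smul_unitVec_ne hij]
        ring
      have ψj : HasLineDerivTwo ψ (unitVec j) (2 * M) y := by
        refine hasLineDerivTwo_of_quadratic (α := ψ y) (β := M * (2 * (y j - x j))) fun s => ?_
        simp only [hψ, add_smul_unitVec_same, add_smul_unitVec_ne hij.symm]
        ring
      have ρi := (hasLineDerivTwo_re hfρ.1 i).comp_line (σ := -1) (by norm_num) (fun s => by
        simp only [hρ, add_smul_unitVec_same]; module)
      have ρj := (hasLineDerivTwo_re hfρ.1 j).comp_line (σ := 1) (by norm_num) (fun s => by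
        simp only [hρ, add_smul_unitVec_ne hij.symm]; module)
      refine ⟨_, _, (((hasLineDerivTwo_re hfy.1 i).sub ρi).const_mul (1 / 2)).sub ψi,
        (((hasLineDerivTwo_re hfy.1 j).sub ρj).const_mul (1 / 2)).sub ψj, ?_⟩
      have l1 := (abs_lt.1 ((Complex.abs_re_le_norm _).trans_lt hfy.2.2)).1
      have l2 := (abs_lt.1 ((Complex.abs_re_le_norm _).trans_lt hfρ.2.2)).2
      rw [laplacian_eq_of_ne hij, Complex.add_re] at l1 l2
      linarith
  have hdf : DifferentiableAt ℝ f x := (h x (by simp)).1.differentiableAt (by simp)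
  have d1 : HasDerivAt (fun t : ℝ => (f (x + t • unitVec i)).re) (pd i f x).re 0 := by
    have := Complex.reCLM.hasFDerivAt.comp_hasDerivAt (0 : ℝ)
      (hasDerivAt_line (f := f) (x := x) i 0 (by simpa using hdf))
    simp only [zero_smul, add_zero] at this
    exact this
  have d2 : HasDerivAt (fun t : ℝ => (f (x + (-t) • unitVec i)).re) (-(pd i f x).re) 0 := by
    have hd1 : HasDerivAt (fun t : ℝ => (f (x + t • unitVec i)).re) (pd i f x).re (-0) := by
      simpa using d1
    have := hd1.comp (0 : ℝ) (hasDerivAt_neg 0)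
    simpa [Function.comp_def] using this
  -- The one-sided difference quotient of the odd part at `x` tends to `Re ∂_i f`; `hmain` bounds it
  -- by that of `ψ`.
  have d3 := ((d1.sub d2).const_mul (1 / 2)).tendsto_slope_zero_right
  have hlim : 1 / 2 * ((pd i f x).re - -(pd i f x).re) ≤ 2 * M + N / 2 := by
    refine le_of_tendsto d3 ?_
    filter_upwards [Ioo_mem_nhdsGT (zero_lt_one (α := ℝ))] with t ht
    have hy := hmain (x + t • unitVec i)
      ⟨by simp [add_smul_unitVec_ne hij], by simp [ht.1.le], by simp [ht.2.le]⟩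
    have hρt : ρ (x + t • unitVec i) = x + (-t) • unitVec i := by
      simp only [hρ, add_smul_unitVec_same]; module
    simp only [hz, hψ, hρt, add_smul_unitVec_same, add_smul_unitVec_ne hij] at hy
    have ht0 : 0 < t := ht.1
    simp only [Pi.sub_apply, zero_add, neg_zero, zero_smul, add_zero, sub_self, mul_zero, sub_zero,
      smul_eq_mul]
    rw [inv_mul_le_iff₀ ht0]
    nlinarith [mul_nonneg hM (sq_nonneg t), mul_nonneg hN.le (sq_nonneg t)]
  linarith

/-- Multiplying `f` by a unimodular constant that makes `∂_i f(x)` a positive real changes neither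
hypothesis and reduces the claim to the real part. -/
lemma norm_pd_le {f : Plane → ℂ} {x : Plane} (i : Fin 2) {M N : ℝ}
    (h : ∀ y, ‖y - x‖ ≤ 2 → ContDiffAt ℝ ∞ f y ∧ ‖f y‖ ≤ M ∧ ‖laplacian f y‖ < N) :
    ‖pd i f x‖ ≤ 2 * M + N / 2 := by
  obtain ⟨j, hij⟩ : ∃ j, i ≠ j := ⟨i + 1, by fin_cases i <;> simp⟩
  have hM : 0 ≤ M := (norm_nonneg _).trans (h x (by simp)).2.1
  have hN : 0 < N := (norm_nonneg _).trans_lt (h x (by simp)).2.2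
  by_cases h0 : pd i f x = 0
  · rw [h0, norm_zero]; positivity
  have hn : (‖pd i f x‖ : ℂ) ≠ 0 := by simpa using h0
  set c : ℂ := starRingEnd ℂ (pd i f x) / ‖pd i f x‖ with hc
  have hc1 : ‖c‖ = 1 := by
    simp [hc, h0]
  have hcp : c * pd i f x = ‖pd i f x‖ := by
    rw [hc, div_mul_eq_mul_div, mul_comm, Complex.mul_conj, Complex.normSq_eq_norm_sq]
    field_simp
    push_cast; ring
  have key := re_pd_le (f := fun y => c * f y) (x := x) hij (M := M) (N := N) ?_
  · rw [pd_const_mul i c ((h x (by simp)).1.differentiableAt (by simp)), hcp] at key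
    simpa using key
  · intro y hy
    obtain ⟨h1, h2, h3⟩ := h y hy
    have hpp : ∀ μ, pd μ (pd μ fun y => c * f y) y = c * pd μ (pd μ f) y := by
      intro μ
      have h1' : ContDiffAt ℝ 1 f y := h1.of_le (by exact_mod_cast le_top)
      have he : (pd μ fun y => c * f y) =ᶠ[𝓝 y] fun y => c * pd μ f y := by
        filter_upwards [h1'.eventually (by simp)] with w hw
        exact pd_const_mul μ c (hw.differentiableAt (by simp))
      rw [pd_congr μ he, pd_const_mul μ c ((contDiffAt_pd μ h1).differentiableAt (by simp))]
    refine ⟨contDiffAt_const.mul h1, by simpa [hc1] using h2, ?_⟩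
    have : laplacian (fun y => c * f y) y = c * laplacian f y := by
      simp only [laplacian, hpp]; ring
    rw [this, norm_mul, hc1, one_mul]
    exact h3

/-! ### Decay of bounded subsolutions -/

lemma norm_sq_line (x : Plane) (μ : Fin 2) (s : ℝ) :
    ‖x + s • unitVec μ‖ ^ 2 = ‖x‖ ^ 2 + 2 * x μ * s + s ^ 2 := by
  obtain ⟨j, hij⟩ : ∃ j, μ ≠ j := ⟨μ + 1, by fin_cases μ <;> simp⟩
  rw [norm_sq_eq_of_ne hij, norm_sq_eq_of_ne hij, add_smul_unitVec_same, add_smul_unitVec_ne hij]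
  ring

lemma hasLineDerivTwo_norm_zpow {x : Plane} (hx : x ≠ 0) (m : ℤ) (μ : Fin 2) :
    HasLineDerivTwo (fun y => (‖y‖ ^ 2) ^ m) (unitVec μ)
      (m * (((m - 1 : ℤ) * (‖x‖ ^ 2) ^ (m - 1 - 1) * (2 * x μ)) * (2 * x μ)
        + (‖x‖ ^ 2) ^ (m - 1) * 2)) x := by
  set p : ℝ → ℝ := fun s => ‖x‖ ^ 2 + 2 * x μ * s + s ^ 2 with hp
  have hp0 : p 0 = ‖x‖ ^ 2 := by simp [hp]
  have hpos : p 0 ≠ 0 := by rw [hp0]; positivity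
  have hd : ∀ t, HasDerivAt p (2 * x μ + 2 * t) t := fun t => by
    have h1 := ((hasDerivAt_id t).const_mul (2 * x μ)).const_add (‖x‖ ^ 2)
    exact (h1.add ((hasDerivAt_id t).pow 2)).congr_deriv (by simp)
  have hz : ∀ (k : ℤ) (t : ℝ), p t ≠ 0 →
      HasDerivAt (fun s => p s ^ k) (k * p t ^ (k - 1) * (2 * x μ + 2 * t)) t :=
    fun k t h => (hasDerivAt_zpow k (p t) (Or.inl h)).comp t (hd t)
  refine ⟨fun t => m * (p t ^ (m - 1) * (2 * x μ + 2 * t)), ?_, ?_⟩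
  · filter_upwards [(hd 0).continuousAt.eventually_ne hpos] with t ht
    simp only [norm_sq_line]
    exact (hz m t ht).congr_deriv (by ring)
  · have hlin : HasDerivAt (fun t : ℝ => 2 * x μ + 2 * t) 2 0 := by
      simpa using ((hasDerivAt_id (0 : ℝ)).const_mul 2).const_add (2 * x μ)
    refine (((hz (m - 1) 0 hpos).mul hlin).const_mul (m : ℝ)).congr_deriv ?_
    rw [hp0]; simp

/-- The planar formula `Δ r²ᵐ = 4 m² r²ᵐ⁻²`. Integer exponents cover both parts of the barrier, `m =
-n` and `m = 1`. -/
lemma exists_hasLineDerivTwo_norm_zpow {x : Plane} (hx : x ≠ 0) (m : ℤ) :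
    ∃ a b : ℝ, HasLineDerivTwo (fun y => (‖y‖ ^ 2) ^ m) (unitVec 0) a x ∧
      HasLineDerivTwo (fun y => (‖y‖ ^ 2) ^ m) (unitVec 1) b x ∧
      a + b = 4 * (m : ℝ) ^ 2 * (‖x‖ ^ 2) ^ (m - 1) := by
  refine ⟨_, _, hasLineDerivTwo_norm_zpow hx m 0, hasLineDerivTwo_norm_zpow hx m 1, ?_⟩
  have h : (‖x‖ ^ 2) ^ (m - 1) = (‖x‖ ^ 2) ^ (m - 1 - 1) * (x 0 ^ 2 + x 1 ^ 2) := by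
    rw [← norm_sq_eq_of_ne (by simp : (0 : Fin 2) ≠ 1), ← zpow_add_one₀ (by positivity)]
    congr 1; ring
  rw [h]; push_cast; ring

/-- A bounded function with `Δw ≥ w - C r⁻²ⁿ` near infinity, wherever it is positive, is
`O(r⁻²ⁿ)` from above. -/
lemma exists_re_le_of_laplacian_ge {w : Plane → ℂ}
    (hw : ∀ᶠ x in Bornology.cobounded Plane, ContDiffAt ℝ ∞ w x)
    (hb : w =O[Bornology.cobounded Plane] fun _ => (1 : ℝ)) (n : ℕ) (C : ℝ)
    (h : ∀ᶠ x in Bornology.cobounded Plane, 0 < (w x).re →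
      (w x).re - C * ((‖x‖ ^ 2) ^ n)⁻¹ ≤ (laplacian w x).re) :
    ∃ M, ∀ᶠ x in Bornology.cobounded Plane, (w x).re ≤ M * ((‖x‖ ^ 2) ^ n)⁻¹ := by
  obtain ⟨W, hW⟩ := hb.bound
  obtain ⟨R, -, hR⟩ := hasBasis_cobounded_norm.eventually_iff.1 (hw.and (hW.and h))
  -- Beyond this radius `r² ≥ 8n² + 8`, so the barrier `b` below satisfies `Δb ≤ b / 2`.
  set R₀ : ℝ := max R (8 * n ^ 2 + 8) with hR₀
  have hR₀8 : 8 * (n : ℝ) ^ 2 + 8 ≤ R₀ := le_max_right _ _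
  have hR₀1 : 1 ≤ R₀ := by nlinarith [sq_nonneg (n : ℝ)]
  have hall : ∀ y : Plane, R₀ ≤ ‖y‖ → ContDiffAt ℝ ∞ w y ∧ ‖w y‖ ≤ W ∧ (0 < (w y).re →
      (w y).re - C * ((‖y‖ ^ 2) ^ n)⁻¹ ≤ (laplacian w y).re) := by
    intro y hy
    obtain ⟨h1, h2, h3⟩ := hR (show y ∈ {x | R ≤ ‖x‖} from (le_max_left _ _).trans hy)
    exact ⟨h1, by simpa using h2, h3⟩
  obtain ⟨y₀, hy₀⟩ : ∃ y : Plane, ‖y‖ = R₀ :=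
    ⟨R₀ • unitVec 0, by rw [norm_smul]; simp; linarith⟩
  have hW0 : 0 ≤ W := (norm_nonneg _).trans (hall y₀ hy₀.ge).2.1
  -- The term `W R₀²ⁿ` puts the barrier above `w` on the inner circle. The term `2|C| + 1` makes
  -- half the barrier strictly exceed the source `C r⁻²ⁿ`.
  set M : ℝ := 2 * |C| + 1 + W * (R₀ ^ 2) ^ n with hM
  have hM0 : 0 < M := by positivity
  refine ⟨M, hasBasis_cobounded_norm.eventually_iff.2 ⟨R₀, trivial, fun x hx => ?_⟩⟩
  have hx : R₀ ≤ ‖x‖ := hx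
  have hx0 : 0 < ‖x‖ := by linarith
  refine le_of_forall_pos_le_add fun δ hδ => ?_
  -- At the fixed point `x` the growing term `ε r²` costs exactly `δ`. On the circle of radius `R₂`
  -- it is at least `W`, so `w` lies below the barrier there too.
  set ε : ℝ := δ / ‖x‖ ^ 2 with hε
  have hε0 : 0 < ε := by positivity
  set R₂ : ℝ := ‖x‖ + W / ε with hR₂
  have hWε : 0 ≤ W / ε := by positivity
  set S : Set Plane := {y | R₀ ≤ ‖y‖ ∧ ‖y‖ ≤ R₂} with hS
  set b : Plane → ℝ := fun y => M * (‖y‖ ^ 2) ^ (-n : ℤ) - (-ε) * (‖y‖ ^ 2) ^ (1 : ℤ) with hbdef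
  have hSc : IsCompact S := by
    have c1 : IsClosed {y : Plane | R₀ ≤ ‖y‖} := isClosed_le continuous_const continuous_norm
    have c2 : IsClosed {y : Plane | ‖y‖ ≤ R₂} := isClosed_le continuous_norm continuous_const
    refine (isCompact_closedBall (0 : Plane) R₂).of_isClosed_subset (c1.inter c2) fun y hy => ?_
    simpa using hy.2
  have hne : ∀ y ∈ S, y ≠ 0 := fun y hy => norm_pos_iff.1 (by linarith [hy.1])
  have hcont : ContinuousOn (fun y => (w y).re - b y) S := by
    intro y hy
    have c1 : ContinuousAt (fun y => (w y).re) y :=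
      Complex.continuous_re.continuousAt.comp (hall y hy.1).1.continuousAt
    have hy2 : ‖y‖ ^ 2 ≠ 0 := by simpa using hne y hy
    have c2 : ∀ m : ℤ, ContinuousAt (fun y : Plane => (‖y‖ ^ 2) ^ m) y := fun m =>
      (continuous_norm.pow 2).continuousAt.zpow₀ m (Or.inl hy2)
    exact (c1.sub (((c2 _).const_mul M).sub ((c2 _).const_mul (-ε)))).continuousWithinAt
  have hmain := nonpos_of_laplacian_pos (e := unitVec 0) (e' := unitVec 1) hSc hcont ?_ x
    ⟨hx, by linarith⟩
  · have : ε * ‖x‖ ^ 2 = δ := by rw [hε]; field_simp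
    simp only [hbdef, zpow_neg, zpow_natCast, zpow_one] at hmain
    linarith
  intro y hy hpos
  obtain ⟨h1, h2, h3⟩ := hall y hy.1
  have hy0 := hne y hy
  set q : ℝ := ‖y‖ ^ 2 with hq
  have hq0 : 0 < q := by positivity
  have hqR : R₀ ^ 2 ≤ q := pow_le_pow_left₀ (by linarith) hy.1 2
  have hq8 : 8 * (n : ℝ) ^ 2 + 8 ≤ q := by nlinarith
  set Q : ℝ := (q ^ n)⁻¹ with hQ
  have hQ0 : 0 < Q := by positivity
  have hby : b y = M * Q + ε * q := by
    simp only [hbdef, zpow_neg, zpow_natCast, zpow_one]; ring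
  have hwle : (w y).re ≤ W := (Complex.re_le_norm _).trans h2
  have hbW : b y < W := by linarith
  have hi1 : R₀ < ‖y‖ := by
    refine lt_of_le_of_ne hy.1 fun he => ?_
    have hqe : q = R₀ ^ 2 := by rw [hq, he]
    have : W * (R₀ ^ 2) ^ n * Q = W := by rw [hQ, hqe]; field_simp
    have hsplit : M * Q = (2 * |C| + 1) * Q + W := by
      rw [hM, add_mul _ (W * _), this]
    have : 0 ≤ (2 * |C| + 1) * Q := by positivity
    have : 0 ≤ ε * q := by positivity
    linarith
  have hi2 : ‖y‖ < R₂ := by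
    refine lt_of_le_of_ne hy.2 fun he => ?_
    have h4 : W / ε ≤ q := by
      have : W / ε ≤ ‖y‖ := by rw [he]; linarith
      nlinarith [hy.1]
    have h5 : W ≤ ε * q := by rwa [div_le_iff₀' hε0] at h4
    have : 0 ≤ M * Q := by positivity
    linarith
  obtain ⟨a₁, b₁, ha₁, hb₁, hab₁⟩ := exists_hasLineDerivTwo_norm_zpow hy0 (-n)
  obtain ⟨a₂, b₂, ha₂, hb₂, hab₂⟩ := exists_hasLineDerivTwo_norm_zpow hy0 1
  refine ⟨?_, _, _, (hasLineDerivTwo_re h1 0).sub ((ha₁.const_mul M).sub (ha₂.const_mul (-ε))),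
    (hasLineDerivTwo_re h1 1).sub ((hb₁.const_mul M).sub (hb₂.const_mul (-ε))), ?_⟩
  · have o1 : ∀ᶠ v : Plane in 𝓝 y, R₀ < ‖v‖ :=
      (isOpen_lt continuous_const continuous_norm).mem_nhds hi1
    have o2 : ∀ᶠ v : Plane in 𝓝 y, ‖v‖ < R₂ :=
      (isOpen_lt continuous_norm continuous_const).mem_nhds hi2
    filter_upwards [o1, o2] with v v1 v2 using ⟨v1.le, v2.le⟩
  have hQ' : (‖y‖ ^ 2) ^ (-(n : ℤ) - 1) = Q / q := by
    rw [zpow_sub_one₀ (by positivity), zpow_neg, zpow_natCast]; rfl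
  rw [hQ'] at hab₁
  simp only [sub_self, zpow_zero] at hab₂
  have hlw := h3 (by
    have : 0 < b y := by rw [hby]; positivity
    linarith)
  have hlap : (laplacian w y).re = (pd 0 (pd 0 w) y).re + (pd 1 (pd 1 w) y).re := by
    simp [laplacian]
  have hCQ : C * Q ≤ |C| * Q := mul_le_mul_of_nonneg_right (le_abs_self C) hQ0.le
  have hMQ : (2 * |C| + 1) * Q ≤ M * Q := by
    refine mul_le_mul_of_nonneg_right ?_ hQ0.le
    have : 0 ≤ W * (R₀ ^ 2) ^ n := by positivity
    linarith
  have hMQ' : M * (4 * (n : ℝ) ^ 2 * (Q / q)) ≤ M * Q / 2 := by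
    have : 4 * (n : ℝ) ^ 2 * (Q / q) ≤ Q / 2 := by
      rw [← mul_div_assoc, div_le_iff₀ hq0]
      have := mul_le_mul_of_nonneg_left hq8 hQ0.le
      linarith
    have := mul_le_mul_of_nonneg_left this hM0.le
    linarith
  have hεq : 4 * ε ≤ ε * q / 2 := by
    have := mul_le_mul_of_nonneg_left hq8 hε0.le
    have : 0 ≤ ε * (8 * (n : ℝ) ^ 2) := by positivity
    linarith
  have e1 : M * a₁ + M * b₁ = M * (4 * (n : ℝ) ^ 2 * (Q / q)) := by
    rw [← mul_add, hab₁]; push_cast; ring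
  have e2 : ε * a₂ + ε * b₂ = 4 * ε := by
    rw [← mul_add, hab₂]; push_cast; ring
  rw [hby] at hpos
  linarith

/-! ### Functions with decaying derivatives -/

/-- The filter of neighbourhoods of infinity in the plane. -/
local notation "∞ᵖ" => Bornology.cobounded Plane

/-- Enlarging the radius leaves room for a neighbourhood of each point. This is what allows
identities valid near infinity to be differentiated. -/
lemma eventually_eventually_nhds_of_cobounded {p : Plane → Prop} (h : ∀ᶠ x in ∞ᵖ, p x) :
    ∀ᶠ x in ∞ᵖ, ∀ᶠ y in 𝓝 x, p y := by
  obtain ⟨R, -, hR⟩ := hasBasis_cobounded_norm.eventually_iff.1 h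
  refine hasBasis_cobounded_norm.eventually_iff.2 ⟨R + 1, trivial, fun x hx => ?_⟩
  have hx' : R < ‖x‖ := by
    have : R + 1 ≤ ‖x‖ := hx
    linarith
  filter_upwards [(isOpen_lt continuous_const continuous_norm).mem_nhds hx'] with y hy
  exact hR (le_of_lt hy)

/-- `f` is smooth near infinity. -/
def SmoothNearInfty (f : Plane → ℂ) : Prop := ∀ᶠ x in ∞ᵖ, ContDiffAt ℝ ∞ f x

namespace SmoothNearInfty

variable {f g : Plane → ℂ}

lemma congr (hf : SmoothNearInfty f) (h : f =ᶠ[∞ᵖ] g) : SmoothNearInfty g := by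
  filter_upwards [hf, eventually_eventually_nhds_of_cobounded h] with x h1 h2
  exact h1.congr_of_eventuallyEq (h2.mono fun y hy => hy.symm)

lemma differentiable (hf : SmoothNearInfty f) : ∀ᶠ x in ∞ᵖ, DifferentiableAt ℝ f x :=
  hf.mono fun _ hx => hx.differentiableAt (by simp)

lemma pd (hf : SmoothNearInfty f) (μ : Fin 2) : SmoothNearInfty (pd μ f) :=
  hf.mono fun _ hx => contDiffAt_pd μ hx

lemma add (hf : SmoothNearInfty f) (hg : SmoothNearInfty g) :
    SmoothNearInfty fun x => f x + g x := by
  filter_upwards [hf, hg] with x h1 h2 using h1.add h2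

lemma mul (hf : SmoothNearInfty f) (hg : SmoothNearInfty g) :
    SmoothNearInfty fun x => f x * g x := by
  filter_upwards [hf, hg] with x h1 h2 using h1.mul h2

lemma const (c : ℂ) : SmoothNearInfty fun _ => c :=
  Eventually.of_forall fun _ => contDiffAt_const

lemma conj (hf : SmoothNearInfty f) : SmoothNearInfty fun x => starRingEnd ℂ (f x) :=
  hf.mono fun _ hx => Complex.conjCLE.contDiff.contDiffAt.comp _ hx

lemma inv (hf : SmoothNearInfty f) (h0 : ∀ᶠ x in ∞ᵖ, f x ≠ 0) :
    SmoothNearInfty fun x => (f x)⁻¹ := by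
  filter_upwards [hf, h0] with x h1 h2 using h1.inv h2

end SmoothNearInfty

lemma pd_eventuallyEq {f g : Plane → ℂ} (μ : Fin 2) (h : f =ᶠ[∞ᵖ] g) : pd μ f =ᶠ[∞ᵖ] pd μ g := by
  filter_upwards [eventually_eventually_nhds_of_cobounded h] with x hx using pd_congr μ hx

lemma laplacian_pd_eventuallyEq {f : Plane → ℂ} (hf : SmoothNearInfty f) (μ : Fin 2) :
    pd μ (laplacian f) =ᶠ[∞ᵖ] laplacian (pd μ f) := by
  have hcomm : ∀ ν, pd μ (pd ν (pd ν f)) =ᶠ[∞ᵖ] pd ν (pd ν (pd μ f)) := by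
    intro ν
    have h1 : pd μ (pd ν f) =ᶠ[∞ᵖ] pd ν (pd μ f) := hf.mono fun x hx => pd_pd_comm hx μ ν
    have h2 : pd μ (pd ν (pd ν f)) =ᶠ[∞ᵖ] pd ν (pd μ (pd ν f)) :=
      (hf.pd ν).mono fun x hx => pd_pd_comm hx μ ν
    exact h2.trans (pd_eventuallyEq ν h1)
  filter_upwards [hcomm 0, hcomm 1, ((hf.pd 0).pd 0).differentiable,
    ((hf.pd 1).pd 1).differentiable] with x h0 h1 d0 d1
  have : pd μ (laplacian f) x = pd μ (pd 0 (pd 0 f)) x + pd μ (pd 1 (pd 1 f)) x :=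
    pd_add μ d0 d1
  rw [this, h0, h1]; rfl

namespace DecaysAtRate

variable {f g : Plane → ℂ} {m m' : ℕ}

lemma congr (hf : DecaysAtRate f m) (h : f =ᶠ[∞ᵖ] g) : DecaysAtRate g m :=
  hf.congr' h EventuallyEq.rfl

lemma mul (hf : DecaysAtRate f m) (hg : DecaysAtRate g m') :
    DecaysAtRate (fun x => f x * g x) (m + m') :=
  (IsBigO.mul hf hg).congr_right fun x => by rw [pow_add, mul_inv]

lemma mono (hf : DecaysAtRate f m) (h : m' ≤ m) : DecaysAtRate f m' := by
  refine hf.trans (IsBigO.of_bound 1 ?_)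
  filter_upwards [hasBasis_cobounded_norm.mem_of_mem (i := (1 : ℝ)) trivial] with x hx
  have hx : 1 ≤ ‖x‖ := hx
  rw [one_mul, Real.norm_of_nonneg (by positivity), Real.norm_of_nonneg (by positivity)]
  gcongr

lemma conj (hf : DecaysAtRate f m) : DecaysAtRate (fun x => starRingEnd ℂ (f x)) m := by
  refine IsBigO.trans (IsBigO.of_bound 1 (Eventually.of_forall fun x => ?_)) hf
  simp

/-- The interior gradient estimate at infinity. -/
lemma pd (hf : DecaysAtRate f m) (hs : SmoothNearInfty f) (hl : DecaysAtRate (laplacian f) m)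
    (μ : Fin 2) : DecaysAtRate (pd μ f) m := by
  obtain ⟨C, hC, hfC⟩ := IsBigO.exists_pos hf
  obtain ⟨C', hC', hlC⟩ := IsBigO.exists_pos hl
  obtain ⟨R, -, hR⟩ := hasBasis_cobounded_norm.eventually_iff.1
    (hs.and (hfC.bound.and hlC.bound))
  -- On the ball of radius 2 about `x` with `‖x‖ ≥ 4` one has `‖y‖ ≥ ‖x‖ / 2`, hence the factor `2 ^
  -- m`. The `+ 1` supplies the strict inequality required by `norm_pd_le`.
  refine IsBigO.of_bound (2 * (C * 2 ^ m) + (C' + 1) * 2 ^ m / 2) ?_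
  refine hasBasis_cobounded_norm.eventually_iff.2 ⟨max R 0 + 4, trivial, fun x hx => ?_⟩
  have hx : max R 0 + 4 ≤ ‖x‖ := hx
  have hRx : R + 4 ≤ ‖x‖ := by linarith [le_max_left R 0]
  have h4x : 4 ≤ ‖x‖ := by linarith [le_max_right R 0]
  have hp : 0 < (‖x‖ ^ m)⁻¹ := by positivity
  rw [Real.norm_of_nonneg hp.le, add_mul]
  have key : ∀ y : Plane, ‖y - x‖ ≤ 2 → R ≤ ‖y‖ ∧ (‖y‖ ^ m)⁻¹ ≤ 2 ^ m * (‖x‖ ^ m)⁻¹ := by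
    intro y hy
    have h1 : ‖x‖ - 2 ≤ ‖y‖ := by
      have := norm_sub_norm_le x y
      rw [norm_sub_rev] at this
      linarith
    refine ⟨by linarith, ?_⟩
    have h2 : ‖x‖ / 2 ≤ ‖y‖ := by linarith
    calc (‖y‖ ^ m)⁻¹ ≤ ((‖x‖ / 2) ^ m)⁻¹ := by gcongr
      _ = 2 ^ m * (‖x‖ ^ m)⁻¹ := by rw [div_pow, inv_div, div_eq_mul_inv]
  refine (norm_pd_le μ (M := C * (2 ^ m * (‖x‖ ^ m)⁻¹))
    (N := (C' + 1) * (2 ^ m * (‖x‖ ^ m)⁻¹)) fun y hy => ?_).trans (le_of_eq (by ring))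
  obtain ⟨hRy, hle⟩ := key y hy
  obtain ⟨h1, h2, h3⟩ := hR (show y ∈ {x | R ≤ ‖x‖} from hRy)
  rw [Real.norm_of_nonneg (by positivity)] at h2 h3
  refine ⟨h1, h2.trans (by gcongr), h3.trans_lt ?_⟩
  have : 0 < 2 ^ m * (‖x‖ ^ m)⁻¹ := by positivity
  nlinarith

end DecaysAtRate

/-- `f` is smooth near infinity, and its partial derivatives of order at most `n` are `O(r⁻ᵐ)`. -/
def DerivsDecay (m : ℕ) : ℕ → (Plane → ℂ) → Prop
  | 0, f => SmoothNearInfty f ∧ DecaysAtRate f m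
  | n + 1, f => (SmoothNearInfty f ∧ DecaysAtRate f m) ∧ ∀ μ, DerivsDecay m n (pd μ f)

namespace DerivsDecay

variable {m m' n : ℕ} {f g : Plane → ℂ}

lemma base (hf : DerivsDecay m n f) : SmoothNearInfty f ∧ DecaysAtRate f m := by
  cases n with
  | zero => exact hf
  | succ n => exact hf.1

lemma of_succ (hf : DerivsDecay m (n + 1) f) : DerivsDecay m n f := by
  induction n generalizing f with
  | zero => exact hf.1
  | succ n ih => exact ⟨hf.1, fun μ => ih (hf.2 μ)⟩

lemma congr (hf : DerivsDecay m n f) (h : f =ᶠ[∞ᵖ] g) : DerivsDecay m n g := by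
  induction n generalizing f g with
  | zero => exact ⟨hf.1.congr h, hf.2.congr h⟩
  | succ n ih =>
    exact ⟨⟨hf.1.1.congr h, hf.1.2.congr h⟩, fun μ => ih (hf.2 μ) (pd_eventuallyEq μ h)⟩

lemma mono_rate (hf : DerivsDecay m n f) (h : m' ≤ m) : DerivsDecay m' n f := by
  induction n generalizing f with
  | zero => exact ⟨hf.1, hf.2.mono h⟩
  | succ n ih => exact ⟨⟨hf.1.1, hf.1.2.mono h⟩, fun μ => ih (hf.2 μ)⟩

lemma add (hf : DerivsDecay m n f) (hg : DerivsDecay m n g) :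
    DerivsDecay m n fun x => f x + g x := by
  induction n generalizing f g with
  | zero => exact ⟨hf.1.add hg.1, IsBigO.add hf.2 hg.2⟩
  | succ n ih =>
    refine ⟨⟨hf.1.1.add hg.1.1, IsBigO.add hf.1.2 hg.1.2⟩, fun μ => ?_⟩
    refine (ih (hf.2 μ) (hg.2 μ)).congr ?_
    filter_upwards [hf.1.1.differentiable, hg.1.1.differentiable] with x h1 h2
    exact (pd_add μ h1 h2).symm

lemma mul (hf : DerivsDecay m n f) (hg : DerivsDecay m' n g) :
    DerivsDecay (m + m') n fun x => f x * g x := by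
  induction n generalizing f g with
  | zero => exact ⟨hf.1.mul hg.1, hf.2.mul hg.2⟩
  | succ n ih =>
    refine ⟨⟨hf.1.1.mul hg.1.1, hf.1.2.mul hg.1.2⟩, fun μ => ?_⟩
    refine ((ih (hf.2 μ) hg.of_succ).add (ih hf.of_succ (hg.2 μ))).congr ?_
    filter_upwards [hf.1.1.differentiable, hg.1.1.differentiable] with x h1 h2
    exact (pd_mul μ h1 h2).symm

lemma zero (m n : ℕ) : DerivsDecay m n fun _ => 0 := by
  have h : SmoothNearInfty (fun _ => 0) ∧ DecaysAtRate (fun _ => 0) m :=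
    ⟨SmoothNearInfty.const 0, isBigO_zero _ _⟩
  induction n with
  | zero => exact h
  | succ n ih => exact ⟨h, fun μ => ih.congr (Eventually.of_forall fun x => (pd_const μ 0 x).symm)⟩

lemma const (n : ℕ) (c : ℂ) : DerivsDecay 0 n fun _ => c := by
  have h : SmoothNearInfty (fun _ => c) ∧ DecaysAtRate (fun _ => c) 0 :=
    ⟨SmoothNearInfty.const c, by simpa [DecaysAtRate] using isBigO_const_const c (one_ne_zero (α := ℝ)) ∞ᵖ⟩
  cases n with
  | zero => exact h
  | succ n =>
    exact ⟨h, fun μ => (zero 0 n).congr (Eventually.of_forall fun x => (pd_const μ c x).symm)⟩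

lemma const_mul (c : ℂ) (hf : DerivsDecay m n f) : DerivsDecay m n fun x => c * f x := by
  simpa using (const n c).mul hf

lemma sub (hf : DerivsDecay m n f) (hg : DerivsDecay m n g) :
    DerivsDecay m n fun x => f x - g x := by
  simpa [sub_eq_add_neg] using hf.add (hg.const_mul (-1))

lemma conj (hf : DerivsDecay m n f) : DerivsDecay m n fun x => starRingEnd ℂ (f x) := by
  induction n generalizing f with
  | zero => exact ⟨hf.1.conj, hf.2.conj⟩
  | succ n ih =>
    refine ⟨⟨hf.1.1.conj, hf.1.2.conj⟩, fun μ => (ih (hf.2 μ)).congr ?_⟩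
    filter_upwards [hf.1.1.differentiable] with x h1 using (pd_conj μ h1).symm

/-- Elliptic regularity: control of `f` and `Δf` gives control of one more derivative of `f`. -/
lemma succ_of_laplacian (hf : DerivsDecay m n f) (hl : DerivsDecay m n (laplacian f)) :
    DerivsDecay m (n + 1) f := by
  induction n generalizing f with
  | zero => exact ⟨hf, fun μ => ⟨hf.1.pd μ, hf.2.pd hf.1 hl.2 μ⟩⟩
  | succ n ih =>
    exact ⟨hf.1, fun μ => ih (hf.2 μ) ((hl.2 μ).congr (laplacian_pd_eventuallyEq hf.1.1 μ))⟩

end DerivsDecay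

/-- `f` is smooth near infinity and bounded with all its derivatives. -/
def DerivsBounded (f : Plane → ℂ) : Prop := ∀ n, DerivsDecay 0 n f

/-- `f` is smooth near infinity, and it and all its derivatives decay faster than any power. -/
def RapidDecay (f : Plane → ℂ) : Prop := ∀ m n, DerivsDecay m n f

namespace DerivsBounded

variable {f g : Plane → ℂ}

lemma mul (hf : DerivsBounded f) (hg : DerivsBounded g) : DerivsBounded fun x => f x * g x :=
  fun n => (hf n).mul (hg n)

lemma conj (hf : DerivsBounded f) : DerivsBounded fun x => starRingEnd ℂ (f x) :=
  fun n => (hf n).conj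

lemma pd (hf : DerivsBounded f) (μ : Fin 2) : DerivsBounded (pd μ f) := fun n => (hf (n + 1)).2 μ

end DerivsBounded

namespace RapidDecay

variable {f g : Plane → ℂ}

lemma smooth (hf : RapidDecay f) : SmoothNearInfty f := (hf 0 0).1

lemma decaysAtRate (hf : RapidDecay f) (m : ℕ) : DecaysAtRate f m := (hf m 0).2

lemma bounded (hf : RapidDecay f) : DerivsBounded f := hf 0

lemma congr (hf : RapidDecay f) (h : f =ᶠ[∞ᵖ] g) : RapidDecay g := fun m n => (hf m n).congr h

lemma add (hf : RapidDecay f) (hg : RapidDecay g) : RapidDecay fun x => f x + g x :=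
  fun m n => (hf m n).add (hg m n)

lemma sub (hf : RapidDecay f) (hg : RapidDecay g) : RapidDecay fun x => f x - g x :=
  fun m n => (hf m n).sub (hg m n)

lemma mul_bounded (hf : RapidDecay f) (hg : DerivsBounded g) : RapidDecay fun x => f x * g x :=
  fun m n => (hf m n).mul (hg n)

lemma const_mul (c : ℂ) (hf : RapidDecay f) : RapidDecay fun x => c * f x :=
  fun m n => (hf m n).const_mul c

lemma conj (hf : RapidDecay f) : RapidDecay fun x => starRingEnd ℂ (f x) :=
  fun m n => (hf m n).conj

lemma pd (hf : RapidDecay f) (μ : Fin 2) : RapidDecay (pd μ f) := fun m n => (hf m (n + 1)).2 μ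

lemma dz (hf : RapidDecay f) : RapidDecay (dz f) :=
  ((hf.pd 0).sub ((hf.pd 1).const_mul _)).const_mul _

lemma dzbar (hf : RapidDecay f) : RapidDecay (dzbar f) :=
  ((hf.pd 0).add ((hf.pd 1).const_mul _)).const_mul _

lemma sum {ι : Type*} (s : Finset ι) {F : ι → Plane → ℂ} (h : ∀ i ∈ s, RapidDecay (F i)) :
    RapidDecay fun x => ∑ i ∈ s, F i x := by
  classical
  induction s using Finset.induction_on with
  | empty => exact fun m n => DerivsDecay.zero m n
  | insert a s ha ih =>
    simp only [Finset.sum_insert ha]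
    exact (h a (Finset.mem_insert_self a s)).add (ih fun i hi => h i (Finset.mem_insert_of_mem hi))

/-- Bidifferential operators map rapidly decaying functions to such functions. -/
lemma bidiff_left (n : ℕ) (hf : RapidDecay f) (hg : DerivsBounded g) :
    RapidDecay (bidiff n f g) := by
  induction n generalizing f g with
  | zero => exact hf.mul_bounded hg
  | succ n ih => exact (ih (hf.pd 0) (hg.pd 1)).sub (ih (hf.pd 1) (hg.pd 0))

/-- This serves `φ₀`, which does not decay itself: once the operator has positive order, every term
differentiates `f`, so decay of its gradient is enough. -/
lemma bidiff_succ (n : ℕ) (hf : ∀ μ, RapidDecay (NCVortex.pd μ f)) (hg : DerivsBounded g) :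
    RapidDecay (bidiff (n + 1) f g) :=
  (bidiff_left n (hf 0) (hg.pd 1)).sub (bidiff_left n (hf 1) (hg.pd 0))

end RapidDecay

/-! ### Decay of solutions -/

lemma laplacian_neg (w : Plane → ℂ) (x : Plane) :
    laplacian (fun y => -w y) x = -laplacian w x := by
  have h : ∀ (μ : Fin 2) (g : Plane → ℂ), pd μ (fun y => -g y) = fun y => -pd μ g y := by
    intro μ g
    funext y
    simp [pd, fderiv_fun_neg]
  simp only [laplacian, h]
  ring

/-- The one-sided bound applies to `w` and to `-w`; since `w` is real near infinity, the two
together bound its norm. -/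
lemma decaysAtRate_of_laplacian {w : Plane → ℂ} (hs : SmoothNearInfty w)
    (hb : w =O[∞ᵖ] fun _ => (1 : ℝ)) (him : ∀ᶠ x in ∞ᵖ, (w x).im = 0) (n : ℕ) (C : ℝ)
    (hpos : ∀ᶠ x in ∞ᵖ, 0 < (w x).re →
      (w x).re - C * ((‖x‖ ^ 2) ^ n)⁻¹ ≤ (laplacian w x).re)
    (hneg : ∀ᶠ x in ∞ᵖ, (w x).re < 0 →
      (laplacian w x).re ≤ (w x).re + C * ((‖x‖ ^ 2) ^ n)⁻¹) :
    DecaysAtRate w (2 * n) := by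
  obtain ⟨M₁, h₁⟩ := exists_re_le_of_laplacian_ge hs hb n C hpos
  obtain ⟨M₂, h₂⟩ := exists_re_le_of_laplacian_ge (w := fun y => -w y)
    (hs.mono fun x hx => hx.neg) hb.neg_left n C (by
      filter_upwards [hneg] with x hx h0
      rw [laplacian_neg]
      simp only [Complex.neg_re] at h0 ⊢
      linarith [hx (by linarith)])
  refine IsBigO.of_bound (max M₁ M₂) ?_
  filter_upwards [h₁, h₂, him] with x a b c
  have hp : 0 ≤ ((‖x‖ ^ 2) ^ n)⁻¹ := by positivity
  rw [pow_mul, Real.norm_of_nonneg hp, ← Complex.abs_re_eq_norm.2 c, abs_le]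
  have m1 := mul_le_mul_of_nonneg_right (le_max_left M₁ M₂) hp
  have m2 := mul_le_mul_of_nonneg_right (le_max_right M₁ M₂) hp
  simp only [Complex.neg_re] at b
  constructor <;> linarith

/-- Bootstrap on `∂_μ f = f h_μ`: bounds on `n` derivatives of `f` give bounds on `n + 1`. It is
used for `φ₀` and for `1 / φ₀`, neither of which decays. -/
lemma derivsBounded_of_pd_eq_mul {f : Plane → ℂ} {h : Fin 2 → Plane → ℂ} (hs : SmoothNearInfty f)
    (hb : DecaysAtRate f 0) (hh : ∀ μ, DerivsBounded (h μ))
    (hpd : ∀ μ, pd μ f =ᶠ[∞ᵖ] fun x => f x * h μ x) : DerivsBounded f := by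
  intro n
  induction n with
  | zero => exact ⟨hs, hb⟩
  | succ n ih => exact ⟨⟨hs, hb⟩, fun μ => (ih.mul (hh μ n)).congr (hpd μ).symm⟩

/-! ### Complex derivatives -/

lemma dz_add {f g : Plane → ℂ} {x : Plane} (hf : DifferentiableAt ℝ f x)
    (hg : DifferentiableAt ℝ g x) : dz (fun y => f y + g y) x = dz f x + dz g x := by
  simp only [dz, pd_add _ hf hg]; ring

lemma dzbar_add {f g : Plane → ℂ} {x : Plane} (hf : DifferentiableAt ℝ f x)
    (hg : DifferentiableAt ℝ g x) : dzbar (fun y => f y + g y) x = dzbar f x + dzbar g x := by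
  simp only [dzbar, pd_add _ hf hg]; ring

lemma dz_const_mul {f : Plane → ℂ} {x : Plane} (c : ℂ) (hf : DifferentiableAt ℝ f x) :
    dz (fun y => c * f y) x = c * dz f x := by
  simp only [dz, pd_const_mul _ c hf]; ring

lemma dzbar_const_mul {f : Plane → ℂ} {x : Plane} (c : ℂ) (hf : DifferentiableAt ℝ f x) :
    dzbar (fun y => c * f y) x = c * dzbar f x := by
  simp only [dzbar, pd_const_mul _ c hf]; ring

lemma dzbar_mul {f g : Plane → ℂ} {x : Plane} (hf : DifferentiableAt ℝ f x)
    (hg : DifferentiableAt ℝ g x) :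
    dzbar (fun y => f y * g y) x = dzbar f x * g x + f x * dzbar g x := by
  simp only [dzbar, pd_mul _ hf hg]; ring

lemma dz_eventuallyEq {f g : Plane → ℂ} (h : f =ᶠ[∞ᵖ] g) : dz f =ᶠ[∞ᵖ] dz g := by
  filter_upwards [pd_eventuallyEq 0 h, pd_eventuallyEq 1 h] with x h0 h1
  simp only [dz, h0, h1]

lemma dzbar_eventuallyEq {f g : Plane → ℂ} (h : f =ᶠ[∞ᵖ] g) : dzbar f =ᶠ[∞ᵖ] dzbar g := by
  filter_upwards [pd_eventuallyEq 0 h, pd_eventuallyEq 1 h] with x h0 h1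
  simp only [dzbar, h0, h1]

lemma conj_dzbar {f : Plane → ℂ} {x : Plane} (hf : DifferentiableAt ℝ f x) :
    starRingEnd ℂ (dzbar f x) = dz (fun y => starRingEnd ℂ (f y)) x := by
  simp only [dzbar, dz, pd_conj _ hf, map_mul, map_add, map_div₀, map_one, Complex.conj_ofReal,
    Complex.conj_I]
  ring

lemma inv_sqrt_two_sq : (1 / (Real.sqrt 2 : ℂ)) * (1 / (Real.sqrt 2 : ℂ)) = 1 / 2 := by
  rw [div_mul_div_comm, ← Complex.ofReal_mul, Real.mul_self_sqrt (by norm_num)]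
  norm_num

lemma SmoothNearInfty.dz {f : Plane → ℂ} (hf : SmoothNearInfty f) : SmoothNearInfty (dz f) :=
  (SmoothNearInfty.const (1 / (Real.sqrt 2 : ℂ))).mul ((hf.pd 0).add (((SmoothNearInfty.const (-Complex.I)).mul
    (hf.pd 1)))) |>.congr (Eventually.of_forall fun x => by simp only [NCVortex.dz]; ring)

lemma SmoothNearInfty.dzbar {f : Plane → ℂ} (hf : SmoothNearInfty f) :
    SmoothNearInfty (dzbar f) :=
  (SmoothNearInfty.const _).mul ((hf.pd 0).add (((SmoothNearInfty.const _).mul (hf.pd 1))))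

lemma dz_dzbar {f : Plane → ℂ} {x : Plane} (hf : ContDiffAt ℝ ∞ f x) :
    dz (dzbar f) x = laplacian f x / 2 := by
  have d0 := (contDiffAt_pd 0 hf).differentiableAt (by simp)
  have d1 := (contDiffAt_pd 1 hf).differentiableAt (by simp)
  have h : dz (dzbar f) x = (1 / (Real.sqrt 2 : ℂ)) * (dz (pd 0 f) x
      + Complex.I * dz (pd 1 f) x) := by
    rw [← dz_const_mul _ d1, ← dz_add d0 (d1.const_mul _),
      ← dz_const_mul _ (d0.fun_add (d1.const_mul _))]
    rfl
  rw [h]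
  simp only [dz, laplacian, pd_pd_comm hf 1 0]
  linear_combination (pd 0 (pd 0 f) x - Complex.I * Complex.I * pd 1 (pd 1 f) x) * inv_sqrt_two_sq
    - 1 / 2 * pd 1 (pd 1 f) x * Complex.I_mul_I

lemma dzbar_dz {f : Plane → ℂ} {x : Plane} (hf : ContDiffAt ℝ ∞ f x) :
    dzbar (dz f) x = laplacian f x / 2 := by
  have d0 := (contDiffAt_pd 0 hf).differentiableAt (by simp)
  have d1 := (contDiffAt_pd 1 hf).differentiableAt (by simp)
  have h : dzbar (dz f) x = (1 / (Real.sqrt 2 : ℂ)) * (dzbar (pd 0 f) x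
      + -Complex.I * dzbar (pd 1 f) x) := by
    rw [← dzbar_const_mul _ d1, ← dzbar_add d0 (d1.const_mul _),
      ← dzbar_const_mul _ (d0.fun_add (d1.const_mul _))]
    congr 1
    funext y
    simp only [dz]; ring
  rw [h]
  simp only [dzbar, laplacian, pd_pd_comm hf 1 0]
  linear_combination (pd 0 (pd 0 f) x - Complex.I * Complex.I * pd 1 (pd 1 f) x) * inv_sqrt_two_sq
    - 1 / 2 * pd 1 (pd 1 f) x * Complex.I_mul_I

/-- The linear part of the magnetic field, for a potential `ā = -i (∂̄v + d)` with `v` real. -/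
lemma magnetic_linear {a v d : Plane → ℂ} (hv : SmoothNearInfty v) (hd : SmoothNearInfty d)
    (hreal : ∀ᶠ x in ∞ᵖ, (v x).im = 0)
    (ha : (fun x => starRingEnd ℂ (a x)) =ᶠ[∞ᵖ] fun x => -Complex.I * (dzbar v x + d x)) :
    ∀ᶠ x in ∞ᵖ, -Complex.I * (dz (fun y => starRingEnd ℂ (a y)) x - dzbar a x) =
      -(laplacian v x + dz d x + dzbar (fun y => starRingEnd ℂ (d y)) x) := by
  have hvv : (fun x => starRingEnd ℂ (v x)) =ᶠ[∞ᵖ] v :=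
    hreal.mono fun x hx => Complex.conj_eq_iff_im.2 hx
  -- Conjugating `ha` and using that `v` is real turns `∂̄v` into `∂v`.
  have ha' : a =ᶠ[∞ᵖ] fun x => Complex.I * (dz v x + starRingEnd ℂ (d x)) := by
    filter_upwards [ha, hv.differentiable, dz_eventuallyEq hvv] with x h1 h2 h3
    have := congrArg (starRingEnd ℂ) h1
    rw [Complex.conj_conj] at this
    rw [this, map_mul, map_add, conj_dzbar h2, h3]
    simp
  filter_upwards [dz_eventuallyEq ha, dzbar_eventuallyEq ha', hv, hd.differentiable,
    hv.dz.differentiable, hv.dzbar.differentiable, hd.conj.differentiable]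
    with x h1 h2 h3 h4 h5 h6 h7
  rw [h1, h2, dz_const_mul _ (h6.fun_add h4), dzbar_const_mul _ (h5.fun_add h7), dz_add h6 h4,
    dzbar_add h5 h7, dz_dzbar h3, dzbar_dz h3]
  linear_combination (laplacian v x + dz d x + dzbar (fun y => starRingEnd ℂ (d y)) x)
    * Complex.I_mul_I

/-! ### The source terms -/

/-- The part of the coefficient of `θᵐ⁺¹` in the Moyal product that contains derivatives. -/
noncomputable def moyalHigher (f g : FormalField) (m : ℕ) (x : Plane) : ℂ :=
  ∑ p ∈ Finset.HasAntidiagonal.antidiagonal m, ∑ q ∈ Finset.HasAntidiagonal.antidiagonal p.2,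
    (1 / ((p.1 + 1).factorial : ℂ)) * (Complex.I / 2) ^ (p.1 + 1) *
      bidiff (p.1 + 1) (f q.1) (g q.2) x

lemma moyal_succ (f g : FormalField) (m : ℕ) (x : Plane) :
    moyal f g (m + 1) x = ∑ q ∈ Finset.HasAntidiagonal.antidiagonal (m + 1), f q.1 x * g q.2 x
      + moyalHigher f g m x := by
  simp only [moyal, moyalHigher, Finset.Nat.sum_antidiagonal_succ]
  simp [bidiff]

lemma moyal_zero (f g : FormalField) (x : Plane) : moyal f g 0 x = f 0 x * g 0 x := by
  simp [moyal, bidiff]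

lemma moyalHigher_rapidDecay {f g : FormalField} {m : ℕ}
    (h : ∀ i ≤ m, ∀ j ≤ m, ∀ n, RapidDecay (bidiff (n + 1) (f i) (g j))) :
    RapidDecay (moyalHigher f g m) := by
  refine RapidDecay.sum _ fun p hp => RapidDecay.sum _ fun q hq => ?_
  rw [Finset.HasAntidiagonal.mem_antidiagonal] at hp hq
  exact (h q.1 (by omega) q.2 (by omega) p.1).const_mul _

/-- The terms `f_i g_j` with `i + j = k` and `i, j ≠ 0`. -/
noncomputable def convInner (f g : FormalField) (k : ℕ) (x : Plane) : ℂ :=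
  ∑ q ∈ ((Finset.HasAntidiagonal.antidiagonal k).erase (0, k)).erase (k, 0), f q.1 x * g q.2 x

lemma sum_antidiagonal_eq_convInner (f g : FormalField) {k : ℕ} (hk : k ≠ 0) (x : Plane) :
    ∑ q ∈ Finset.HasAntidiagonal.antidiagonal k, f q.1 x * g q.2 x =
      convInner f g k x + f k x * g 0 x + f 0 x * g k x := by
  have h1 : ((0, k) : ℕ × ℕ) ∈ Finset.HasAntidiagonal.antidiagonal k := by simp
  have h2 : ((k, 0) : ℕ × ℕ) ∈ (Finset.HasAntidiagonal.antidiagonal k).erase (0, k) := by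
    simp [hk]
  rw [convInner, ← Finset.sum_erase_add _ _ h1, ← Finset.sum_erase_add _ _ h2]

lemma convInner_rapidDecay {f g : FormalField} {k : ℕ}
    (h : ∀ i < k, ∀ j < k, i ≠ 0 → j ≠ 0 → RapidDecay fun x => f i x * g j x) :
    RapidDecay (convInner f g k) := by
  refine RapidDecay.sum _ fun q hq => ?_
  simp only [Finset.mem_erase, Finset.HasAntidiagonal.mem_antidiagonal, ne_eq, Prod.ext_iff] at hq
  exact h q.1 (by omega) q.2 (by omega) (by omega) (by omega)

/-- The inductive hypothesis on the coefficients of order `j`. -/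
def CoeffDecay (A φ : FormalField) (j : ℕ) : Prop :=
  RapidDecay (A j) ∧ DerivsBounded (φ j) ∧ (∀ μ, RapidDecay (pd μ (φ j))) ∧
    (j ≠ 0 → RapidDecay (φ j))

/-- Nothing of order `k` survives: the subtracted terms remove `φ_k`, and the undifferentiated part
of the commutator cancels because pointwise multiplication commutes, which removes `A_k`. -/
lemma sourceC_rapidDecay {A φ : FormalField} {k : ℕ} (hk : k ≠ 0)
    (h : ∀ j < k, CoeffDecay A φ j) : RapidDecay (sourceC A φ k) := by
  obtain ⟨m, rfl⟩ := Nat.exists_eq_succ_of_ne_zero hk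
  have hA : ∀ j ≤ m, RapidDecay (A j) := fun j hj => (h j (by omega)).1
  have r1 : RapidDecay (moyalHigher A (conjField A) m) := moyalHigher_rapidDecay
    fun i hi j hj n => RapidDecay.bidiff_left _ (hA i hi) (hA j hj).conj.bounded
  have r2 : RapidDecay (moyalHigher (conjField A) A m) := moyalHigher_rapidDecay
    fun i hi j hj n => RapidDecay.bidiff_left _ (hA i hi).conj (hA j hj).bounded
  have r3 : RapidDecay (moyalHigher φ (conjField φ) m) := moyalHigher_rapidDecay
    fun i hi j hj n => RapidDecay.bidiff_succ n (h i (by omega)).2.2.1 (h j (by omega)).2.1.conj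
  have r4 : RapidDecay (convInner φ (conjField φ) (m + 1)) := convInner_rapidDecay
    fun i hi j hj hi0 _ => ((h i hi).2.2.2 hi0).mul_bounded (h j hj).2.1.conj
  refine ((r2.sub r1).add (r3.add r4)).congr (Eventually.of_forall fun x => ?_)
  have hswap : ∑ q ∈ Finset.HasAntidiagonal.antidiagonal (m + 1), conjField A q.1 x * A q.2 x
      = ∑ q ∈ Finset.HasAntidiagonal.antidiagonal (m + 1), A q.1 x * conjField A q.2 x := by
    rw [← Finset.Nat.sum_antidiagonal_swap]
    exact Finset.sum_congr rfl fun q _ => mul_comm _ _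
  simp only [sourceC, moyalComm, Nat.succ_eq_add_one, moyal_succ, hswap,
    sum_antidiagonal_eq_convInner φ _ (Nat.succ_ne_zero m)]
  ring

/-- Every term left in `D_k` carries some `Ā_j` with `j < k`, which decays rapidly even when it
meets the non-decaying `φ₀`. -/
lemma sourceD_rapidDecay {A φ : FormalField} {k : ℕ} (hk : k ≠ 0)
    (h : ∀ j < k, CoeffDecay A φ j) : RapidDecay (sourceD A φ k) := by
  obtain ⟨m, rfl⟩ := Nat.exists_eq_succ_of_ne_zero hk
  have r1 : RapidDecay (moyalHigher (conjField A) φ m) := moyalHigher_rapidDecay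
    fun i hi j hj n => RapidDecay.bidiff_left _ (h i (by omega)).1.conj (h j (by omega)).2.1
  have r2 : RapidDecay (convInner (conjField A) φ (m + 1)) := convInner_rapidDecay
    fun i hi j hj _ _ => (h i hi).1.conj.mul_bounded (h j hj).2.1
  refine ((r1.add r2).const_mul (-Complex.I)).congr (Eventually.of_forall fun x => ?_)
  simp only [sourceD, Nat.succ_eq_add_one, moyal_succ,
    sum_antidiagonal_eq_convInner _ φ (Nat.succ_ne_zero m)]
  ring

/-! ### The commutative vortex -/

lemma pd_log {f : Plane → ℂ} {x : Plane} (μ : Fin 2) (hf : DifferentiableAt ℝ f x)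
    (h0 : f x ∈ Complex.slitPlane) : pd μ (fun y => Complex.log (f y)) x = pd μ f x / f x := by
  have h := (((Complex.hasDerivAt_log h0).hasFDerivAt.restrictScalars ℝ).comp x
    hf.hasFDerivAt).fderiv
  simp only [pd]
  rw [show (fun y => Complex.log (f y)) = Complex.log ∘ f from rfl, h]
  simp
  ring

lemma pd_exp {f : Plane → ℂ} {x : Plane} (μ : Fin 2) (hf : DifferentiableAt ℝ f x) :
    pd μ (fun y => Complex.exp (f y)) x = Complex.exp (f x) * pd μ f x := by
  have h := (((Complex.hasDerivAt_exp (f x)).hasFDerivAt.restrictScalars ℝ).comp x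
    hf.hasFDerivAt).fderiv
  simp only [pd]
  rw [show (fun y => Complex.exp (f y)) = Complex.exp ∘ f from rfl, h]
  simp
  ring

/-- A real function of modulus tending to `1` has a real logarithm of its modulus, tending to
`0`. -/
lemma exists_log_norm {f : Plane → ℂ} (hf : SmoothNearInfty f)
    (hreal : ∀ᶠ x in ∞ᵖ, (f x).im = 0) (htend : Tendsto (fun x => ‖f x‖) ∞ᵖ (𝓝 1)) :
    ∃ u : Plane → ℂ, SmoothNearInfty u ∧ (∀ᶠ x in ∞ᵖ, (u x).im = 0) ∧ Tendsto u ∞ᵖ (𝓝 0) ∧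
      (∀ᶠ x in ∞ᵖ, Complex.exp (2 * u x) = f x * f x) ∧
      ∀ μ, pd μ f =ᶠ[∞ᵖ] fun x => f x * pd μ u x := by
  have hsq : ∀ᶠ x in ∞ᵖ, f x * f x = ((‖f x‖ ^ 2 : ℝ) : ℂ) := by
    filter_upwards [hreal] with x hx
    rw [← Complex.normSq_eq_norm_sq, ← Complex.mul_conj, Complex.conj_eq_iff_im.2 hx]
  have hpos : ∀ᶠ x in ∞ᵖ, 0 < ‖f x‖ := htend.eventually (lt_mem_nhds one_pos)
  have hslit : ∀ᶠ x in ∞ᵖ, f x * f x ∈ Complex.slitPlane := by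
    filter_upwards [hsq, hpos] with x h1 h2
    rw [h1]
    exact Complex.ofReal_mem_slitPlane.2 (by positivity)
  have hff : Tendsto (fun x => f x * f x) ∞ᵖ (𝓝 1) := by
    have h1 : Tendsto (fun x => ((‖f x‖ ^ 2 : ℝ) : ℂ)) ∞ᵖ (𝓝 1) := by
      have := (Complex.continuous_ofReal.tendsto _).comp (htend.pow 2)
      simpa [Function.comp_def] using this
    exact h1.congr' (hsq.mono fun x hx => hx.symm)
  have hsm : SmoothNearInfty fun x => Complex.log (f x * f x) := by
    filter_upwards [hf.mul hf, hslit] with x h1 h2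
    exact ((Complex.contDiffAt_log h2).restrict_scalars ℝ).comp x h1
  -- The real function `f` may be negative, so the logarithm is taken of `f²`, which is positive
  -- near infinity.
  refine ⟨fun x => 1 / 2 * Complex.log (f x * f x), (SmoothNearInfty.const _).mul hsm, ?_, ?_, ?_,
    fun μ => ?_⟩
  · filter_upwards [hsq] with x h1
    rw [h1, ← Complex.ofReal_log (by positivity)]
    simp
  · have := ((continuousAt_clog Complex.one_mem_slitPlane).tendsto.comp hff).const_mul (1 / 2 : ℂ)
    simpa [Function.comp_def] using this
  · filter_upwards [hslit] with x h1
    rw [← mul_assoc]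
    norm_num
    rw [Complex.exp_log (Complex.slitPlane_ne_zero h1)]
  · filter_upwards [hslit, hf.differentiable, (hf.mul hf).differentiable, hsm.differentiable]
      with x h1 h2 h3 h4
    have h0 : f x ≠ 0 := fun h => Complex.slitPlane_ne_zero h1 (by simp [h])
    rw [pd_const_mul μ _ h4, pd_log μ h3 h1, pd_mul μ h2 h2]
    field_simp
    ring

/-- The bound `|eᶻ - 1| ≤ 2|z|` for `|z| ≤ 1` starts the induction. It continues because `∂(e²ᵘ - 1)
= 2 (e²ᵘ - 1) ∂u + 2 ∂u`. -/
lemma exp_sub_one_derivsDecay {u : Plane → ℂ} (htend : Tendsto u ∞ᵖ (𝓝 0)) {m n : ℕ}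
    (hu : DerivsDecay m n u) : DerivsDecay m n fun x => Complex.exp (2 * u x) - 1 := by
  have hbase : DerivsDecay m 0 fun x => Complex.exp (2 * u x) - 1 := by
    refine ⟨?_, ?_⟩
    · filter_upwards [hu.base.1] with x hx
      exact (contDiffAt_const.mul hx).cexp.sub contDiffAt_const
    · refine IsBigO.trans (IsBigO.of_bound 4 ?_) hu.base.2
      have h1 : ∀ᶠ x in ∞ᵖ, ‖u x‖ < 1 / 2 :=
        htend.norm.eventually (gt_mem_nhds (by norm_num))
      filter_upwards [h1] with x hx
      have hn : ‖2 * u x‖ = 2 * ‖u x‖ := by simp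
      have := Complex.norm_exp_sub_one_le (x := 2 * u x) (by linarith)
      linarith
  induction n with
  | zero => exact hbase
  | succ n ih =>
    refine ⟨hbase, fun μ => ?_⟩
    have h2 := (((ih hu.of_succ).mul (hu.2 μ)).mono_rate (Nat.le_add_left m m)).add (hu.2 μ)
    refine (h2.const_mul 2).congr ?_
    filter_upwards [hu.base.1.differentiable] with x hx
    have hd : DifferentiableAt ℝ (fun y => 2 * u y) x := hx.const_mul 2
    rw [pd_sub μ hd.cexp (differentiableAt_const 1), pd_exp μ hd, pd_const_mul μ 2 hx, pd_const]
    ring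

/-- Solutions of `Δu = e²ᵘ - 1` that tend to zero at infinity decay rapidly. -/
lemma rapidDecay_of_laplacian_eq_exp {u : Plane → ℂ} (hs : SmoothNearInfty u)
    (hreal : ∀ᶠ x in ∞ᵖ, (u x).im = 0) (htend : Tendsto u ∞ᵖ (𝓝 0))
    (hlap : laplacian u =ᶠ[∞ᵖ] fun x => Complex.exp (2 * u x) - 1) : RapidDecay u := by
  have hlre : ∀ᶠ x in ∞ᵖ, (laplacian u x).re = Real.exp (2 * (u x).re) - 1 := by
    filter_upwards [hlap, hreal] with x h1 h2
    have h3 : u x = ((u x).re : ℂ) := Complex.ext rfl (by simpa using h2)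
    rw [h1, h3]
    have : Complex.exp (2 * ((u x).re : ℂ)) = ((Real.exp (2 * (u x).re) : ℝ) : ℂ) := by
      push_cast; rfl
    rw [Complex.ofReal_re, this, Complex.sub_re, Complex.ofReal_re, Complex.one_re]
  have hsmall : ∀ᶠ x in ∞ᵖ, ‖u x‖ < 1 / 2 := htend.norm.eventually (gt_mem_nhds (by norm_num))
  have hdec : ∀ n, DecaysAtRate u (2 * n) := by
    intro n
    refine decaysAtRate_of_laplacian hs (htend.isBigO_one ℝ) hreal n 0 ?_ ?_
    · filter_upwards [hlre] with x h1 h2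
      rw [h1]
      linarith [Real.add_one_le_exp (2 * (u x).re)]
    -- For `-1/2 ≤ u < 0`, `e²ᵘ ≤ 1 / (1 - 2u)` gives `e²ᵘ - 1 ≤ 2u / (1 - 2u) ≤ u`.
    · filter_upwards [hlre, hsmall] with x h1 h3 h2
      rw [h1]
      have h4 : -(1 / 2) ≤ (u x).re := by
        linarith [(abs_le.1 ((Complex.abs_re_le_norm (u x)).trans h3.le)).1]
      have h5 : -(2 * (u x).re) + 1 ≤ (Real.exp (2 * (u x).re))⁻¹ := by
        rw [← Real.exp_neg]
        exact Real.add_one_le_exp _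
      have h6 : Real.exp (2 * (u x).re) * (-(2 * (u x).re) + 1) ≤ 1 := by
        rwa [← le_div_iff₀' (Real.exp_pos _), one_div]
      nlinarith
  intro m n
  induction n with
  | zero => exact ⟨hs, (hdec m).mono (by omega)⟩
  | succ n ih => exact ih.succ_of_laplacian ((exp_sub_one_derivsDecay htend ih).congr hlap.symm)

/-! ### The higher orders -/

/-- Bounded solutions of `Δv = 2 f² v - E` with `f² → 1` and `E` rapidly decaying decay rapidly. -/
lemma rapidDecay_of_laplacian_eq_linear {f v E : Plane → ℂ} (hs : SmoothNearInfty v)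
    (hreal : ∀ᶠ x in ∞ᵖ, (v x).im = 0) (hb : v =O[∞ᵖ] fun _ => (1 : ℝ))
    (hf : DerivsBounded f) (hfreal : ∀ᶠ x in ∞ᵖ, (f x).im = 0)
    (htend : Tendsto (fun x => ‖f x‖) ∞ᵖ (𝓝 1)) (hE : RapidDecay E)
    (hlap : laplacian v =ᶠ[∞ᵖ] fun x => 2 * (f x * f x) * v x - E x) : RapidDecay v := by
  have hlre : ∀ᶠ x in ∞ᵖ, (laplacian v x).re = 2 * ‖f x‖ ^ 2 * (v x).re - (E x).re := by
    filter_upwards [hlap, hreal, hfreal] with x h1 h2 h3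
    have h4 : f x * f x = ((‖f x‖ ^ 2 : ℝ) : ℂ) := by
      rw [← Complex.normSq_eq_norm_sq, ← Complex.mul_conj, Complex.conj_eq_iff_im.2 h3]
    have h5 : (2 : ℂ) * ((‖f x‖ ^ 2 : ℝ) : ℂ) = ((2 * ‖f x‖ ^ 2 : ℝ) : ℂ) := by push_cast; rfl
    rw [h1, h4, h5, Complex.sub_re, Complex.re_ofReal_mul]
  -- With `f² > 1/2` the coefficient `2 f²` exceeds `1`, the mass required by the comparison lemma.
  have hlarge : ∀ᶠ x in ∞ᵖ, 1 / 2 < ‖f x‖ ^ 2 := by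
    have := htend.pow 2
    rw [one_pow] at this
    exact this.eventually (lt_mem_nhds (by norm_num))
  have hdec : ∀ n, DecaysAtRate v (2 * n) := by
    intro n
    obtain ⟨C, hC⟩ := IsBigO.bound (hE.decaysAtRate (2 * n))
    have hC' : ∀ᶠ x in ∞ᵖ, |(E x).re| ≤ C * ((‖x‖ ^ 2) ^ n)⁻¹ := by
      filter_upwards [hC] with x hx
      rw [pow_mul, Real.norm_of_nonneg (by positivity)] at hx
      exact (Complex.abs_re_le_norm _).trans hx
    refine decaysAtRate_of_laplacian hs hb hreal n C ?_ ?_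
    · filter_upwards [hlre, hlarge, hC'] with x h1 h2 h3 h4
      rw [h1]
      nlinarith [abs_le.1 h3]
    · filter_upwards [hlre, hlarge, hC'] with x h1 h2 h3 h4
      rw [h1]
      nlinarith [abs_le.1 h3]
  intro m n
  induction n with
  | zero => exact ⟨hs, (hdec m).mono (by omega)⟩
  | succ n ih =>
    have h1 := (((hf.mul hf) n).const_mul 2).mul ih
    rw [zero_add] at h1
    exact ih.succ_of_laplacian ((h1.sub (hE m n)).congr hlap.symm)

lemma smoothNearInfty_of_contDiffOn {K : Set Plane} (hK : IsCompact K) {f : Plane → ℂ}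
    (hf : ContDiffOn ℝ ∞ f Kᶜ) : SmoothNearInfty f := by
  have h : ∀ᶠ x in ∞ᵖ, x ∈ Kᶜ := Bornology.isBounded_def.1 hK.isBounded
  exact h.mono fun x hx => hf.contDiffAt (hK.isClosed.isOpen_compl.mem_nhds hx)

/-- The potential at order `k` in terms of `v = φ_k / φ₀`. -/
lemma conj_potential_eq {A φ : FormalField} {k : ℕ} {v : Plane → ℂ} {x : Plane}
    (h0 : covDbar A φ 0 x = 0) (hk : covDbar A φ k x = 0) (hφ0 : φ 0 x ≠ 0)
    (hd : DifferentiableAt ℝ (φ 0) x) (hv : DifferentiableAt ℝ v x)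
    (hφk : φ k =ᶠ[𝓝 x] fun y => φ 0 y * v y) :
    starRingEnd ℂ (A k x) = -Complex.I * (dzbar v x + sourceQuot A φ k x) := by
  have h1 : dzbar (φ k) x = dzbar (φ 0) x * v x + φ 0 x * dzbar v x := by
    rw [← dzbar_mul hd hv]
    simp only [dzbar, pd_congr _ hφk]
  have h2 : φ k x = φ 0 x * v x := hφk.self_of_nhds
  simp only [covDbar, moyal_zero] at h0
  simp only [covDbar, h1] at hk
  simp only [sourceQuot]
  have hD : sourceD A φ k x = φ 0 x * (Complex.I * conjField A k x - dzbar v x) := by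
    simp only [sourceD, h2]
    linear_combination -v x * h0 + hk
  rw [hD, mul_div_cancel_left₀ _ hφ0]
  change conjField A k x = _
  linear_combination conjField A k x * Complex.I_mul_I

/-- With `u = log |φ₀|` the pair of equations collapses to `Δu = e²ᵘ - 1`. The bounds on `1 / φ₀`
are recorded because `d_k` divides by `φ₀`. -/
lemma coeffDecay_zero {A φ : FormalField} (hφ : SmoothNearInfty (φ 0))
    (hvortex : ∀ᶠ x in ∞ᵖ, covDbar A φ 0 x = 0 ∧
      magnetic A 0 x + moyal φ (conjField φ) 0 x - 1 = 0)
    (htend : Tendsto (fun x => ‖φ 0 x‖) ∞ᵖ (𝓝 1)) (hreal : ∀ᶠ x in ∞ᵖ, (φ 0 x).im = 0) :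
    CoeffDecay A φ 0 ∧ DerivsBounded fun x => (φ 0 x)⁻¹ := by
  obtain ⟨u, hu, hureal, hutend, hexp, hpd⟩ := exists_log_norm hφ hreal htend
  have hpos : ∀ᶠ x in ∞ᵖ, φ 0 x ≠ 0 :=
    (htend.eventually (lt_mem_nhds one_pos)).mono fun x hx => norm_pos_iff.1 hx
  have hA : (fun x => starRingEnd ℂ (A 0 x)) =ᶠ[∞ᵖ]
      fun x => -Complex.I * (dzbar u x + (fun _ => (0 : ℂ)) x) := by
    filter_upwards [hvortex, hpos, hpd 0, hpd 1] with x h1 h2 h3 h4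
    have h5 : dzbar (φ 0) x = φ 0 x * dzbar u x := by
      simp only [dzbar, h3, h4]; ring
    have h6 := h1.1
    simp only [covDbar, moyal_zero, h5] at h6
    have h7 : dzbar u x = Complex.I * conjField A 0 x := by
      refine mul_left_cancel₀ h2 ?_
      linear_combination h6
    change conjField A 0 x = _
    rw [h7]
    linear_combination conjField A 0 x * Complex.I_mul_I
  have hlap : laplacian u =ᶠ[∞ᵖ] fun x => Complex.exp (2 * u x) - 1 := by
    filter_upwards [magnetic_linear hu (SmoothNearInfty.const 0) hureal hA, hvortex, hexp, hreal]
      with x h1 h2 h3 h4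
    have h5 := h2.2
    have h6 : conjField φ 0 x = φ 0 x := Complex.conj_eq_iff_im.2 h4
    have h7 : dz (fun _ => (0 : ℂ)) x = 0 := by simp [dz, pd_const]
    have h8 : dzbar (fun _ => starRingEnd ℂ (0 : ℂ)) x = 0 := by simp [dzbar, pd_const]
    simp only [magnetic, moyalComm, moyal_zero, h6] at h5
    rw [h7, h8] at h1
    rw [h3]
    change -Complex.I * (dz (conjField A 0) x - dzbar (A 0) x) = _ at h1
    linear_combination h1 - h5
  have hur := rapidDecay_of_laplacian_eq_exp hu hureal hutend hlap
  have hb : DecaysAtRate (φ 0) 0 := by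
    have : (φ 0) =O[∞ᵖ] fun _ => (1 : ℝ) := (htend.isBigO_one ℝ).of_norm_left
    simpa [DecaysAtRate] using this
  have hφb : DerivsBounded (φ 0) :=
    derivsBounded_of_pd_eq_mul hφ hb (fun μ => (hur.pd μ).bounded) hpd
  have hinvb : DecaysAtRate (fun x => (φ 0 x)⁻¹) 0 := by
    have h1 : Tendsto (fun x => ‖(φ 0 x)⁻¹‖) ∞ᵖ (𝓝 1) := by
      simpa using htend.inv₀ one_ne_zero
    have : (fun x => (φ 0 x)⁻¹) =O[∞ᵖ] fun _ => (1 : ℝ) := (h1.isBigO_one ℝ).of_norm_left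
    simpa [DecaysAtRate] using this
  have hinv : DerivsBounded fun x => (φ 0 x)⁻¹ := by
    refine derivsBounded_of_pd_eq_mul (h := fun μ x => -1 * pd μ u x) (hφ.inv hpos) hinvb
      (fun μ => ((hur.pd μ).const_mul (-1)).bounded) fun μ => ?_
    filter_upwards [hpos, hφ.differentiable, hpd μ] with x h1 h2 h3
    rw [pd_inv μ h2 h1, h3]
    field_simp
  have hAr : RapidDecay (A 0) := by
    have h1 : RapidDecay fun x => starRingEnd ℂ (A 0 x) :=
      (hur.dzbar.const_mul (-Complex.I)).congr (hA.symm.mono fun x hx => by simpa using hx)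
    simpa using h1.conj
  exact ⟨⟨hAr, hφb, fun μ => ((hur.pd μ).mul_bounded hφb).congr
    ((hpd μ).symm.mono fun x hx => (mul_comm _ _).trans hx), fun h => absurd rfl h⟩, hinv⟩

lemma sourceQuot_rapidDecay {A φ : FormalField} {k : ℕ} (hk : k ≠ 0)
    (h : ∀ j < k, CoeffDecay A φ j) (hinv : DerivsBounded fun x => (φ 0 x)⁻¹) :
    RapidDecay (sourceQuot A φ k) :=
  (sourceD_rapidDecay hk h).mul_bounded hinv

lemma sourceE_rapidDecay {A φ : FormalField} {k : ℕ} (hk : k ≠ 0)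
    (h : ∀ j < k, CoeffDecay A φ j) (hinv : DerivsBounded fun x => (φ 0 x)⁻¹) :
    RapidDecay (sourceE A φ k) := by
  have hd := sourceQuot_rapidDecay hk h hinv
  refine ((hd.dz.add hd.conj.dzbar).sub (sourceC_rapidDecay hk h)).congr
    (Eventually.of_forall fun x => ?_)
  simp only [sourceE]
  ring

/-- Dividing by `φ₀` eliminates `A_k`: the first equation expresses it through `v = φ_k / φ₀` and
`d_k`, and the second then becomes a linear massive equation for the bounded real function `v`, with
source `E_k`. -/
lemma coeffDecay_of_lt {A φ : FormalField} {k : ℕ} (hk : k ≠ 0)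
    (h : ∀ j < k, CoeffDecay A φ j) (hinv : DerivsBounded fun x => (φ 0 x)⁻¹)
    (hφ : SmoothNearInfty (φ k)) (hb : φ k =O[∞ᵖ] fun _ => (1 : ℝ))
    (hvortex₀ : ∀ᶠ x in ∞ᵖ, covDbar A φ 0 x = 0)
    (hvortex : ∀ᶠ x in ∞ᵖ, covDbar A φ k x = 0 ∧
      magnetic A k x + moyal φ (conjField φ) k x = 0)
    (htend : Tendsto (fun x => ‖φ 0 x‖) ∞ᵖ (𝓝 1)) (hreal₀ : ∀ᶠ x in ∞ᵖ, (φ 0 x).im = 0)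
    (hreal : ∀ᶠ x in ∞ᵖ, (φ k x).im = 0) : CoeffDecay A φ k := by
  have hφ0 := (h 0 (Nat.pos_of_ne_zero hk)).2.1
  have hpos : ∀ᶠ x in ∞ᵖ, φ 0 x ≠ 0 :=
    (htend.eventually (lt_mem_nhds one_pos)).mono fun x hx => norm_pos_iff.1 hx
  have hd := sourceQuot_rapidDecay hk h hinv
  set v : Plane → ℂ := fun x => φ k x * (φ 0 x)⁻¹ with hv
  have hvs : SmoothNearInfty v := hφ.mul (hinv 0).1
  have hφv : φ k =ᶠ[∞ᵖ] fun x => φ 0 x * v x := by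
    filter_upwards [hpos] with x hx
    simp only [hv]
    field_simp
  have hvreal : ∀ᶠ x in ∞ᵖ, (v x).im = 0 := by
    filter_upwards [hreal, hreal₀] with x h1 h2
    simp [hv, Complex.mul_im, h1, h2]
  have hvb : v =O[∞ᵖ] fun _ => (1 : ℝ) := by
    have h1 : (fun x => (φ 0 x)⁻¹) =O[∞ᵖ] fun _ => (1 : ℝ) := by
      simpa [DecaysAtRate] using (hinv 0).2
    exact (hb.mul h1).congr_right fun _ => mul_one 1
  have hA : (fun x => starRingEnd ℂ (A k x)) =ᶠ[∞ᵖ]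
      fun x => -Complex.I * (dzbar v x + sourceQuot A φ k x) := by
    filter_upwards [hvortex₀, hvortex, hpos, (hφ0 0).1.differentiable, hvs.differentiable,
      eventually_eventually_nhds_of_cobounded hφv] with x h1 h2 h3 h4 h5 h6
    exact conj_potential_eq h1 h2.1 h3 h4 h5 h6
  have hlap : laplacian v =ᶠ[∞ᵖ] fun x => 2 * (φ 0 x * φ 0 x) * v x - sourceE A φ k x := by
    filter_upwards [magnetic_linear hvs hd.smooth hvreal hA, hvortex, hφv, hreal, hreal₀]
      with x h1 h2 h3 h4 h5
    have h6 : conjField φ 0 x = φ 0 x := Complex.conj_eq_iff_im.2 h5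
    have h7 : conjField φ k x = φ k x := Complex.conj_eq_iff_im.2 h4
    have h8 := h2.2
    change -Complex.I * (dz (conjField A k) x - dzbar (A k) x) = _ at h1
    simp only [magnetic] at h8
    simp only [sourceE, sourceC, h6, h7, h3]
    linear_combination h1 - h8 + moyalComm A k x * Complex.I_mul_I
  have hvr := rapidDecay_of_laplacian_eq_linear hvs hvreal hvb hφ0 hreal₀ htend
    (sourceE_rapidDecay hk h hinv) hlap
  have hφr : RapidDecay (φ k) := (hvr.mul_bounded hφ0).congr
    (hφv.symm.mono fun x hx => (mul_comm _ _).trans hx)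
  have hAr : RapidDecay (A k) := by
    have h1 : RapidDecay fun x => starRingEnd ℂ (A k x) :=
      ((hvr.dzbar.add hd).const_mul (-Complex.I)).congr hA.symm
    simpa using h1.conj
  exact ⟨hAr, hφr.bounded, fun μ => hφr.pd μ, fun _ => hφr⟩

end NCVortex

theorem mainTheorem4
    (K : Set NCVortex.Plane) (hK : IsCompact K)
    (A φ : NCVortex.FormalField)
    (hA : ∀ k, ContDiffOn ℝ ((⊤ : ℕ∞) : WithTop ℕ∞) (A k) Kᶜ)
    (hφ : ∀ k, ContDiffOn ℝ ((⊤ : ℕ∞) : WithTop ℕ∞) (φ k) Kᶜ)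
    (hvortex : NCVortex.IsVortexOn A φ Kᶜ)
    (hvacuum : Tendsto (fun x => ‖φ 0 x‖) (Bornology.cobounded NCVortex.Plane) (𝓝 1))
    (hgauge : ∀ k, ∀ x ∈ Kᶜ, (φ k x).im = 0)
    (hbounded : ∀ k, 1 ≤ k →
      φ k =O[Bornology.cobounded NCVortex.Plane] fun _ => (1 : ℝ)) :
    ∀ k, 1 ≤ k →
      NCVortex.DecaysAtRate (φ k) (2 * k) ∧
      NCVortex.DecaysAtRate (A k) (2 * k + 1) ∧
      NCVortex.DecaysAtRate (NCVortex.sourceD A φ k) (2 * k + 1) ∧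
      NCVortex.DecaysAtRate (NCVortex.sourceC A φ k) (2 * k + 2) ∧
      NCVortex.DecaysAtRate (NCVortex.sourceE A φ k) (2 * k + 2) := by
  have hout : ∀ᶠ x in Bornology.cobounded NCVortex.Plane, x ∈ Kᶜ :=
    Bornology.isBounded_def.1 hK.isBounded
  have hsmooth := fun k => NCVortex.smoothNearInfty_of_contDiffOn hK (hφ k)
  have hreal := fun k => hout.mono (hgauge k)
  obtain ⟨hzero, hinv⟩ := NCVortex.coeffDecay_zero (A := A) (hsmooth 0)
    (hout.mono fun x hx => by simpa using hvortex 0 x hx) hvacuum (hreal 0)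
  -- Boundedness of `φ_k` is the only growth assumption used at order `k`; the sources are
  -- controlled by the lower orders.
  have hall : ∀ k, NCVortex.CoeffDecay A φ k := by
    intro k
    induction k using Nat.strong_induction_on with
    | _ k ih =>
      rcases eq_or_ne k 0 with rfl | hk
      · exact hzero
      · exact NCVortex.coeffDecay_of_lt hk ih hinv (hsmooth k)
          (hbounded k (Nat.one_le_iff_ne_zero.2 hk)) (hout.mono fun x hx => (hvortex 0 x hx).1)
          (hout.mono fun x hx => by simpa [hk] using hvortex k x hx) hvacuum (hreal 0) (hreal k)
  intro k hk
  have hk0 : k ≠ 0 := Nat.one_le_iff_ne_zero.1 hk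
  exact ⟨((hall k).2.2.2 hk0).decaysAtRate _, (hall k).1.decaysAtRate _,
    (NCVortex.sourceD_rapidDecay hk0 fun j _ => hall j).decaysAtRate _,
    (NCVortex.sourceC_rapidDecay hk0 fun j _ => hall j).decaysAtRate _,
    (NCVortex.sourceE_rapidDecay hk0 (fun j _ => hall j) hinv).decaysAtRate _⟩
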